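/- Let $\mathbb{K}$ be a field of characteristic zero and let $\mathcal{S}=\bigsqcup_{n\in\mathbb{N}}\mathcal{S}(n)$ be a signature (any graded set of symbols). **The Hopf algebra.** An $\mathcal{S}$-term is either the leaf $\perp$ or $(\mathsf{g},(t_1,\dots,t_n))$ with $\mathsf{g}\in\mathcal{S}(n)$ and $t_1,\dots,t_n$ $\mathcal{S}$-terms. Its arity $\mathrm{ar}(t)$ is its number of leaves, its degree is its number of internal nodes, and $t[s_1,\dots,s_{\mathrm{ar}(t)}]$ is obtained by grafting $s_i$ onto the $i$-th leaf of $t$ (the free operad on $\mathcal{S}$, with unit $\perp$). A forest is a word of terms, its degree is the sum of the degrees of its letters, $\mathrm{rd}(w)$ is the word obtained from $w$ by deleting the letters $\perp$, and $w$ is reduced if $\mathrm{rd}(w)=w$. The natural Hopf algebra $\mathbf{N}(\mathcal{S})$ of the free operad on $\mathcal{S}$ has basis $\{\mathsf{E}_f : f \text{ reduced forest}\}$, graded by the degree of $f$, product $\mathsf{E}_f\cdot\mathsf{E}_{f'}=\mathsf{E}_{ff'}$, and as coproduct $\Delta$ the unique algebra morphism such that $\Delta(\mathsf{E}_x)=\sum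 \mathsf{E}_{\mathrm{rd}(y)}\otimes\mathsf{E}_{\mathrm{rd}(w)}$ for every term $x\neq\perp$, where the (finite) sum is over all terms $y$ and words $w=w_1\cdots w_{\mathrm{ar}(y)}$ of terms with $x=y[w_1,\dots,w_{\mathrm{ar}(y)}]$. **Alphabets.** An $\mathcal{S}$-forest-like alphabet is a set $A$ with a unary relation $\mathrm{R}$, a unary relation $\mathrm{D}_{\mathsf{g}}$ for each $\mathsf{g}\in\mathcal{S}$, and a binary relation $\to_j$ for each $j\geq 1$. The disjoint sum $A'\mathbin{+\!\!+}A''$ is $A'\sqcup A''$ with $\mathrm{R}=\mathrm{R}'\sqcup\mathrm{R}''$, $\mathrm{D}_{\mathsf{g}}=\mathrm{D}'_{\mathsf{g}}\sqcup\mathrm{D}''_{\mathsf{g}}$, and $a_1\to_j a_2$ iff $a_1,a_2\in A'$ and $a_1\to'_j a_2$, or $a_1,a_2\in A''$ and $a_1\to''_j a_2$, or $a_1\in A'$, $a_2\in A''$ and $a_2\in\mathrm{R}''$. The alphabet $\mathbb{A}_{\mathcal{S}}$ consists of the letters $\mathbf{a}_{\mathsf{g},u}$, $\mathsf{g}\in\mathcal{S}$,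 $u\in\mathbb{N}^*$ (words on $\mathbb{N}\ni 0$), with $\mathbf{a}_{\mathsf{g},u}\in\mathrm{R}$ iff $u=0^\ell$ for some $\ell\geq 0$, $\mathbf{a}_{\mathsf{g}',u}\in\mathrm{D}_{\mathsf{g}}$ iff $\mathsf{g}'=\mathsf{g}$, and $\mathbf{a}_{\mathsf{g},u}\to_j\mathbf{a}_{\mathsf{g}',u'}$ iff $u'=u\,j\,0^\ell$ for some $\ell\geq 0$. **Realization.** Let $\mathbb{K}\langle A\rangle$ be the space of noncommutative polynomials in the variables $A$, with possibly infinite support but bounded degree. Number the internal nodes of a reduced forest $f$ by $1,\dots,\deg f$ in left-to-right preorder. A word $w\in A^*$ is $f$-compatible if its length is $\deg f$, $w_i\in\mathrm{R}$ whenever $i$ is a root of $f$, $w_i\in\mathrm{D}_{\mathsf{g}}$ whenever $i$ is decorated by $\mathsf{g}$, and $w_i\to_j w_{i'}$ whenever $i'$ is the $j$-th child of $i$. Let $\mathsf{r}_A:\mathbf{N}(\mathcal{S})\to\mathbb{K}\langle A\rangle$ be the linear map sending $\mathsf{E}_f$ to the sum of all $f$-compatible words. **Theorem.** The class of $\mathcal{S}$-forest-like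 alphabets, with the disjoint sum $\mathbin{+\!\!+}$, the maps $\mathsf{r}_A$ and the alphabet $\mathbb{A}_{\mathcal{S}}$, is a polynomial realization of the Hopf algebra $\mathbf{N}(\mathcal{S})$. That is: 1. $\mathbin{+\!\!+}$ is an associative operation on the class of $\mathcal{S}$-forest-like alphabets (up to the canonical identification $(A\sqcup A')\sqcup A''=A\sqcup(A'\sqcup A'')$); 2. for every $\mathcal{S}$-forest-like alphabet $A$, $\mathsf{r}_A$ is a graded linear map (it sends elements of degree $n$ to polynomials homogeneous of degree $n$); 3. (alphabet doubling trick) for all $\mathcal{S}$-forest-like alphabets $A$, $A'$ and all $x\in\mathbf{N}(\mathcal{S})$, $$\theta_{A,A'}(\mathsf{r}_{A\mathbin{+\!\!+}A'}(x))=(\mathsf{r}_A\otimes\mathsf{r}_{A'})(\Delta(x)),$$ where $\theta_{A,A'}$ sends a word $w\in(A\sqcup A')^*$ to $w_{|A}\otimes w_{|A'}$ (its subwords of letters in $A$ and in $A'$) and is extended to infinite linear combinations of words of bounded degree, with values in the possibly infinite linear combinations of the tensors $u\otimes v$, $u\in A^*$, $v\in A'^*$, a space in which $\mathbb{K}\langle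 A\rangle\otimes\mathbb{K}\langle A'\rangle$ embeds canonically; 4. the map $\mathsf{r}_{\mathbb{A}_{\mathcal{S}}}$ is injective. -/

import Mathlib

noncomputable section

open scoped TensorProduct

namespace PolyReal

universe u v

/-- A signature: a set of symbols graded by arity. -/
abbrev Signature : Type (u + 1) := ℕ → Type u

/-- The symbols of a signature, all arities together. -/
abbrev Symbol (S : Signature.{u}) : Type u := Σ n, S n

/-- Terms: a leaf, or a symbol of arity `n` with `n` subterms. -/
inductive Term (S : Signature.{u}) : Type u
  | leaf : Term S
  | node {n : ℕ} (g : S n) (t : Fin n → Term S) : Term S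

namespace Term

variable {S : Signature.{u}}

/-- The arity: the number of leaves. -/
def arity : Term S → ℕ
  | leaf => 1
  | node _ t => ∑ i, (t i).arity

/-- The degree: the number of internal nodes. -/
def deg : Term S → ℕ
  | leaf => 0
  | node _ t => 1 + ∑ i, (t i).deg

/-- The composition of the free operad: graft the root of `s k` onto the `k`-th leaf. -/
def graft : (t : Term S) → (Fin t.arity → Term S) → Term S
  | leaf, s => s (0 : Fin 1)
  | node g t, s => node g fun i => (t i).graft fun k => s (finSigmaFinEquiv ⟨i, k⟩)

/-- In left to right preorder, the number of internal nodes of a composite term that precede those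
of its `i`-th subterm. -/
def start {n : ℕ} (t : Fin n → Term S) (i : Fin n) : ℕ := 1 + ∑ k ∈ Finset.Iio i, (t k).deg

/-- The internal nodes of a term are numbered from `0` in left to right preorder: the root comes
first, followed by the internal nodes of the successive subterms. `t.Deco a s` says that the
internal node `a` of `t` is decorated by `s`. -/
def Deco : Term S → ℕ → Symbol S → Prop
  | leaf, _, _ => False
  | node (n := n) g t, a, s => (a = 0 ∧ s = ⟨n, g⟩) ∨
      ∃ (i : Fin n) (a' : ℕ), (t i).Deco a' s ∧ a = start t i + a'

/-- `t.Edge j a b` says that the internal node `b` of `t` is the `j`-th child of the internal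
node `a`, the children being counted from `1`, leaves included. -/
def Edge : Term S → ℕ+ → ℕ → ℕ → Prop
  | leaf, _, _, _ => False
  | node (n := n) _ t, j, a, b =>
      (a = 0 ∧ ∃ i : Fin n, (i : ℕ) + 1 = j ∧ t i ≠ leaf ∧ b = start t i) ∨
      ∃ (i : Fin n) (a' b' : ℕ), (t i).Edge j a' b' ∧ a = start t i + a' ∧ b = start t i + b'

end Term

/-! Forests are words of terms; their internal nodes are numbered from `0` in left to right
preorder, those of the first term coming first. -/

namespace Forest

variable {S : Signature.{u}}

/-- The degree of a forest. -/
def deg (f : List (Term S)) : ℕ := (f.map Term.deg).sum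

/-- The number of internal nodes that precede those of the `i`-th term. -/
def offset (f : List (Term S)) (i : Fin f.length) : ℕ := ∑ k ∈ Finset.Iio i, (f.get k).deg

/-- The internal node `a` is a root of the forest. -/
def IsRoot (f : List (Term S)) (a : ℕ) : Prop := ∃ i, f.get i ≠ Term.leaf ∧ a = offset f i

/-- The internal node `a` of the forest is decorated by `s`. -/
def Deco (f : List (Term S)) (a : ℕ) (s : Symbol S) : Prop :=
  ∃ i a', (f.get i).Deco a' s ∧ a = offset f i + a'

/-- The internal node `b` is the `j`-th child of the internal node `a` in the forest. -/
def Edge (f : List (Term S)) (j : ℕ+) (a b : ℕ) : Prop :=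
  ∃ i a' b', (f.get i).Edge j a' b' ∧ a = offset f i + a' ∧ b = offset f i + b'

end Forest

open Term

variable {S : Signature.{u}}

/-- The factorizations of `x` in the free operad: all `(y, w)` with
`x = y[w 1, …, w (ar y)]`. -/
abbrev Factorization (x : Term S) : Type u :=
  {p : Σ y : Term S, (Fin y.arity → Term S) // p.1.graft p.2 = x}

theorem ofFn_sigma {α : Type*} [Inhabited α] {m : ℕ} (n : Fin m → ℕ) (w : Fin (∑ i, n i) → α) :
    List.ofFn w =
      (List.ofFn fun i => List.ofFn fun k => w (finSigmaFinEquiv ⟨i, k⟩)).flatten := by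
  have key : ∀ (m : ℕ) (n : Fin m → ℕ) (F : ℕ → α),
      (List.range (∑ i, n i)).map F = (List.ofFn fun i : Fin m =>
        List.ofFn fun k : Fin (n i) =>
          F (∑ j : Fin i, n (Fin.castLE i.2.le j) + k)).flatten := by
    intro m
    induction m with
    | zero => intro n F; simp
    | succ m ih =>
      intro n F
      rw [Fin.sum_univ_castSucc, List.range_add, List.map_append, ih, List.ofFn_succ_last]
      simp only [List.flatten_append, List.flatten_cons, List.flatten_nil, List.append_nil,
        List.map_map]
      congr 1
      apply List.ext_getElem
      · simp
      · intro i h h'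
        simp
        rfl
  have h1 := key m n (fun k => if h : k < ∑ i, n i then w ⟨k, h⟩ else default)
  have h2 : List.ofFn w = (List.range (∑ i, n i)).map
      (fun k => if h : k < ∑ i, n i then w ⟨k, h⟩ else default) := by
    apply List.ext_getElem
    · simp
    · intro i h h'
      have h3 : i < ∑ i, n i := by simpa using h
      simp [h3]
  rw [h2, h1]
  congr 2
  funext i
  congr 1
  funext k
  have := finSigmaFinEquiv_apply (⟨i, k⟩ : (i : Fin m) × Fin (n i))
  have hlt := (finSigmaFinEquiv (⟨i, k⟩ : (i : Fin m) × Fin (n i))).2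
  rw [this] at hlt
  rw [dif_pos hlt]
  congr 1
  exact Fin.ext this.symm

theorem graft_eq_leaf {y : Term S} {w : Fin y.arity → Term S} (h : y.graft w = leaf) :
    (⟨y, w⟩ : Σ y : Term S, (Fin y.arity → Term S)) = ⟨leaf, fun _ => leaf⟩ := by
  cases y with
  | leaf =>
    congr 1
    funext k
    have : k = (0 : Fin 1) := Subsingleton.elim (α := Fin 1) _ _
    rw [this]; exact h
  | node g t => simp [graft] at h

/-- The pair of tuples obtained by putting a tuple of pairs under a symbol. -/
def nodePair {n : ℕ} (g : S n) (q : Fin n → Σ y : Term S, (Fin y.arity → Term S)) :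
    Σ y : Term S, (Fin y.arity → Term S) :=
  ⟨node g fun i => (q i).1,
    fun k => (q (finSigmaFinEquiv.symm k).1).2 (finSigmaFinEquiv.symm k).2⟩

theorem graft_nodePair {n : ℕ} (g : S n) (q : Fin n → Σ y : Term S, (Fin y.arity → Term S)) :
    (nodePair g q).1.graft (nodePair g q).2 = node g fun i => (q i).1.graft (q i).2 := by
  simp only [nodePair, graft]
  congr 1
  funext i
  congr 1
  funext k
  have aux : ∀ z : (i : Fin n) × Fin (q i).1.arity, z = ⟨i, k⟩ →
      (q z.1).2 z.2 = (q i).2 k := by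
    rintro z rfl; rfl
  exact aux _ (Equiv.symm_apply_apply _ _)

theorem nodePair_injective {n : ℕ} (g : S n) :
    Function.Injective (nodePair g) := by
  intro q q' h
  obtain ⟨y, w, rfl⟩ : ∃ (y : Fin n → Term S) (w : ∀ i, Fin (y i).arity → Term S),
      q = fun i => ⟨y i, w i⟩ := ⟨fun i => (q i).1, fun i => (q i).2, rfl⟩
  obtain ⟨y', w', rfl⟩ : ∃ (y : Fin n → Term S) (w : ∀ i, Fin (y i).arity → Term S),
      q' = fun i => ⟨y i, w i⟩ := ⟨fun i => (q' i).1, fun i => (q' i).2, rfl⟩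
  have h1 : y = y' := by
    have := congrArg Sigma.fst h
    simpa [nodePair] using this
  subst h1
  have h2 := eq_of_heq (Sigma.mk.inj h).2
  funext i
  congr 1
  funext k
  have h3 := congrFun h2 (finSigmaFinEquiv ⟨i, k⟩)
  have aux : ∀ (w : ∀ i, Fin (y i).arity → Term S) (z : (i : Fin n) × Fin (y i).arity),
      z = ⟨i, k⟩ → w z.1 z.2 = w i k := by
    rintro w z rfl; rfl
  rw [← aux w _ (Equiv.symm_apply_apply finSigmaFinEquiv _),
    ← aux w' _ (Equiv.symm_apply_apply finSigmaFinEquiv _)]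
  exact h3

/-- The factorizations of a composite term. -/
def factFun {n : ℕ} (g : S n) (t : Fin n → Term S) :
    Option (∀ i, Factorization (t i)) → Factorization (node g t)
  | none => ⟨⟨leaf, fun _ => node g t⟩, rfl⟩
  | some q => ⟨nodePair g fun i => (q i).1, by
      rw [graft_nodePair]; congr 1; funext i; exact (q i).2⟩

theorem factFun_bijective {n : ℕ} (g : S n) (t : Fin n → Term S) :
    Function.Bijective (factFun g t) := by
  constructor
  · rintro (_ | q) (_ | q') h
    · rfl
    · have := congrArg (fun p => p.1.1) h
      simp [factFun, nodePair] at this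
    · have := congrArg (fun p => p.1.1) h
      simp [factFun, nodePair] at this
    · have := nodePair_injective g (congrArg Subtype.val h)
      congr 1
      funext i
      exact Subtype.ext (congrFun this i)
  · rintro ⟨⟨y, w⟩, h⟩
    cases y with
    | leaf =>
      refine ⟨none, Subtype.ext ?_⟩
      simp only [factFun]
      congr 1
      funext k
      have : k = (0 : Fin 1) := Subsingleton.elim (α := Fin 1) _ _
      rw [this]; exact h.symm
    | @node m g' t' =>
      simp only [graft, node.injEq] at h
      obtain ⟨rfl, h⟩ := h
      obtain ⟨h1, h2⟩ := h
      obtain rfl := eq_of_heq h1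
      have h2 := eq_of_heq h2
      refine ⟨some fun i => ⟨⟨t' i, fun k => w (finSigmaFinEquiv ⟨i, k⟩)⟩, congrFun h2 i⟩,
        Subtype.ext ?_⟩
      simp only [factFun, nodePair]
      congr 1
      funext k
      exact congrArg w (Equiv.apply_symm_apply finSigmaFinEquiv k)

instance (x : Term S) : Finite (Factorization x) := by
  induction x with
  | leaf =>
    refine @Finite.of_subsingleton _ ⟨fun p q => Subtype.ext ?_⟩
    exact (graft_eq_leaf p.2).trans (graft_eq_leaf q.2).symm
  | node g t ih => exact Finite.of_surjective _ (factFun_bijective g t).2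

instance (x : Term S) : Fintype (Factorization x) := Fintype.ofFinite _

/-- The terms different from the leaf. -/
abbrev RTerm (S : Signature.{u}) : Type u := {t : Term S // t ≠ leaf}

/-- Reduced forests: words of terms different from the leaf. -/
abbrev RForest (S : Signature.{u}) : Type u := FreeMonoid (RTerm S)

/-- `rd`: delete the letters equal to the leaf, the unit of the free operad. -/
def rd (l : List (Term S)) : RForest S :=
  FreeMonoid.ofList <| l.filterMap fun
    | leaf => none
    | node g t => some ⟨node g t, nofun⟩

/-- The space spanned by the reduced forests, with the concatenation product. -/
def NatHopf (K : Type v) [Field K] (S : Signature.{u}) : Type (max u v) :=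
  MonoidAlgebra K (RForest S)

variable (K : Type v) [Field K]

instance : Ring (NatHopf K S) := inferInstanceAs (Ring (MonoidAlgebra K (RForest S)))

instance : Algebra K (NatHopf K S) :=
  inferInstanceAs (Algebra K (MonoidAlgebra K (RForest S)))

/-- The basis element indexed by a reduced forest. -/
def E (f : RForest S) : NatHopf K S := MonoidAlgebra.of K (RForest S) f

/-- The algebra morphism with prescribed values on the basis elements indexed by terms. -/
def liftE {B : Type*} [Semiring B] [Algebra K B] (φ : RTerm S → B) : NatHopf K S →ₐ[K] B :=
  MonoidAlgebra.lift K B (RForest S) (FreeMonoid.lift φ)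

/-- The coproduct, an algebra morphism whose value on a term `x` is the sum over all
factorizations `x = y[w]` of `E (rd y) ⊗ E (rd w)`. -/
def comulHom : NatHopf K S →ₐ[K] NatHopf K S ⊗[K] NatHopf K S :=
  liftE K fun x => ∑ p : Factorization x.1, E K (rd [p.1.1]) ⊗ₜ[K] E K (rd (List.ofFn p.1.2))

/-- The counit: the coefficient of the empty forest. -/
def counitHom : NatHopf K S →ₐ[K] K := liftE K fun _ => 0

section Hopf

/-- Basis element of a term; the leaf gives `1`. -/
def eT (t : Term S) : NatHopf K S := E K (rd [t])

/-- Basis element of the second component of a pair. -/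
def eW (p : Σ y : Term S, (Fin y.arity → Term S)) : NatHopf K S := E K (rd (List.ofFn p.2))

theorem E_one : E K (1 : RForest S) = 1 := map_one (MonoidAlgebra.of K (RForest S))

theorem E_mul (f f' : RForest S) : E K (f * f') = E K f * E K f' :=
  map_mul (MonoidAlgebra.of K (RForest S)) f f'

theorem liftE_E {B : Type*} [Semiring B] [Algebra K B] (φ : RTerm S → B) (f : RForest S) :
    liftE K φ (E K f) = FreeMonoid.lift φ f :=
  MonoidAlgebra.lift_of _ _

theorem rd_leaf : rd [(leaf : Term S)] = 1 := rfl

theorem rd_of_ne (t : RTerm S) : rd [t.1] = FreeMonoid.of t := by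
  obtain ⟨_ | _, h⟩ := t
  · exact absurd rfl h
  · rfl

theorem rd_append (l l' : List (Term S)) : rd (l ++ l') = rd l * rd l' := by
  simp only [rd, List.filterMap_append]; rfl

theorem eT_leaf : eT K (leaf : Term S) = 1 := E_one K

theorem E_rd (l : List (Term S)) : E K (rd l) = (l.map (eT K)).prod := by
  induction l with
  | nil => exact E_one K
  | cons t l ih =>
    rw [← List.singleton_append, rd_append, E_mul, ih]
    simp [eT]

theorem eW_eq (p : Σ y : Term S, (Fin y.arity → Term S)) :
    eW K p = (List.ofFn fun k => eT K (p.2 k)).prod := by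
  rw [eW, E_rd, List.map_ofFn]; rfl

theorem eW_leaf (x : Term S) : eW K ⟨leaf, fun _ => x⟩ = eT K x := rfl

theorem eW_nodePair {n : ℕ} (g : S n) (q : Fin n → Σ y : Term S, (Fin y.arity → Term S)) :
    eW K (nodePair g q) = (List.ofFn fun i => eW K (q i)).prod := by
  have : Inhabited (NatHopf K S) := ⟨0⟩
  rw [eW_eq]
  refine (congrArg List.prod (ofFn_sigma (fun i => (q i).1.arity) _)).trans ?_
  rw [List.prod_flatten, List.map_ofFn]
  congr 2
  funext i
  rw [eW_eq]
  simp only [Function.comp]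
  congr 2
  funext k
  have aux : ∀ z : (i : Fin n) × Fin (q i).1.arity, z = ⟨i, k⟩ →
      eT K ((q z.1).2 z.2) = eT K ((q i).2 k) := by
    rintro z rfl; rfl
  exact aux _ (Equiv.symm_apply_apply _ _)

theorem liftE_eT {B : Type*} [Semiring B] [Algebra K B] (φ : RTerm S → B) (t : RTerm S) :
    liftE K φ (eT K t.1) = φ t := by
  rw [eT, rd_of_ne, liftE_E, FreeMonoid.lift_eval_of]

theorem sum_fact_leaf {M : Type*} [AddCommMonoid M]
    (F : (Σ y : Term S, (Fin y.arity → Term S)) → M) :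
    ∑ p : Factorization (leaf : Term S), F p.1 = F ⟨leaf, fun _ => leaf⟩ := by
  have : Unique (Factorization (leaf : Term S)) :=
    { default := ⟨⟨leaf, fun _ => leaf⟩, rfl⟩
      uniq := fun p => Subtype.ext (graft_eq_leaf p.2) }
  rw [Fintype.sum_unique]
  exact congrArg F (graft_eq_leaf (default : Factorization (leaf : Term S)).2)

theorem sum_fact_node {M : Type*} [AddCommMonoid M] {n : ℕ} (g : S n) (t : Fin n → Term S)
    (F : (Σ y : Term S, (Fin y.arity → Term S)) → M) :
    ∑ p : Factorization (node g t), F p.1 = F ⟨leaf, fun _ => node g t⟩ +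
      ∑ q : (∀ i, Factorization (t i)), F (nodePair g fun i => (q i).1) := by
  rw [← (Equiv.ofBijective _ (factFun_bijective g t)).sum_comp, Fintype.sum_option]
  rfl

theorem comulHom_eT (x : Term S) :
    comulHom K (eT K x) = ∑ p : Factorization x, eT K p.1.1 ⊗ₜ[K] eW K p.1 := by
  cases x with
  | leaf =>
    rw [sum_fact_leaf (fun p => eT K p.1 ⊗ₜ[K] eW K p), eW_leaf, eT_leaf, map_one]; rfl
  | node g t => exact liftE_eT K _ ⟨node g t, nofun⟩

theorem algHom_ext_eT {B : Type*} [Semiring B] [Algebra K B] {φ ψ : NatHopf K S →ₐ[K] B}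
    (h : ∀ t, φ (eT K t) = ψ (eT K t)) : φ = ψ := by
  refine (MonoidAlgebra.lift K B (RForest S)).symm.injective ?_
  refine FreeMonoid.hom_eq fun t => ?_
  have := h t.1
  rw [eT, rd_of_ne] at this
  exact this

theorem prod_ofFn_sum {B : Type*} [Semiring B] {n : ℕ} {ι : Fin n → Type*}
    [∀ i, Fintype (ι i)] (f : ∀ i, ι i → B) :
    (List.ofFn fun i => ∑ p, f i p).prod = ∑ q : ∀ i, ι i, (List.ofFn fun i => f i (q i)).prod := by
  induction n with
  | zero => simp
  | succ n ih =>
    rw [List.ofFn_succ, List.prod_cons, ih, ← (Fin.consEquiv ι).sum_comp, Fintype.sum_prod_type,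
      Finset.sum_mul]
    refine Finset.sum_congr rfl fun a _ => ?_
    rw [Finset.mul_sum]
    refine Finset.sum_congr rfl fun b _ => ?_
    simp [Fin.consEquiv]

open scoped Classical in
theorem prod_ofFn_ite {B : Type*} [Semiring B] {n : ℕ} (P : Fin n → Prop) (f : Fin n → B) :
    (List.ofFn fun i => if P i then f i else 0).prod =
      if ∀ i, P i then (List.ofFn f).prod else 0 := by
  induction n with
  | zero => simp
  | succ n ih =>
    rw [List.ofFn_succ, List.prod_cons, ih, List.ofFn_succ, List.prod_cons]
    by_cases h0 : P 0 <;> by_cases h1 : ∀ i : Fin n, P i.succ <;> simp [h0, h1, Fin.forall_fin_succ]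

theorem prod_ofFn_tmul {A B : Type*} [Semiring A] [Algebra K A] [Semiring B] [Algebra K B]
    {n : ℕ} (f : Fin n → A) (g : Fin n → B) :
    (List.ofFn f).prod ⊗ₜ[K] (List.ofFn g).prod = (List.ofFn fun i => f i ⊗ₜ[K] g i).prod := by
  induction n with
  | zero => rfl
  | succ n ih => simp [List.ofFn_succ, ← ih]

open scoped Classical in
theorem coassoc_coord (x a : Term S) :
    (∑ p : Factorization x, if p.1.1 = a then comulHom K (eW K p.1) else 0) =
      ∑ p : Factorization x, ∑ q : Factorization p.1.1,
        if q.1.1 = a then eW K q.1 ⊗ₜ[K] eW K p.1 else 0 := by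
  induction x generalizing a with
  | leaf =>
    rw [sum_fact_leaf (fun p => if p.1 = a then comulHom K (eW K p) else 0),
      sum_fact_leaf (fun p => ∑ q : Factorization p.1,
        if q.1.1 = a then eW K q.1 ⊗ₜ[K] eW K p else 0),
      sum_fact_leaf (fun q => if q.1 = a then eW K q ⊗ₜ[K] eW K ⟨leaf, fun _ => leaf⟩ else 0)]
    simp only [eW_leaf, eT_leaf, map_one]
    rfl
  | @node n g t ih =>
    rw [sum_fact_node g t (fun p => if p.1 = a then comulHom K (eW K p) else 0),
      sum_fact_node g t (fun p => ∑ q : Factorization p.1,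
        if q.1.1 = a then eW K q.1 ⊗ₜ[K] eW K p else 0),
      sum_fact_leaf (fun q => if q.1 = a then
        eW K q ⊗ₜ[K] eW K ⟨leaf, fun _ => node g t⟩ else 0)]
    have h1 : ∀ q : (∀ i, Factorization (t i)),
        (∑ s : Factorization (nodePair g fun i => (q i).1).1, if s.1.1 = a then
          eW K s.1 ⊗ₜ[K] eW K (nodePair g fun i => (q i).1) else 0) =
        (if leaf = a then eT K (nodePair g fun i => (q i).1).1 ⊗ₜ[K]
            eW K (nodePair g fun i => (q i).1) else 0) +
          ∑ s : (∀ i, Factorization (q i).1.1), if node g (fun i => (s i).1.1) = a then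
            (List.ofFn fun i => eW K (s i).1 ⊗ₜ[K] eW K (q i).1).prod else 0 := by
      intro q
      refine (sum_fact_node g (fun i => (q i).1.1) (fun s => if s.1 = a then
        eW K s ⊗ₜ[K] eW K (nodePair g fun i => (q i).1) else 0)).trans ?_
      simp only [eW_nodePair, prod_ofFn_tmul]
      rfl
    simp only [h1, Finset.sum_add_distrib, eW_leaf, eT_leaf]
    by_cases ha : leaf = a
    · subst ha
      have hne : ∀ y : Fin n → Term S, node g y ≠ leaf := fun y => nofun
      simp only [nodePair, hne, if_true, if_false, Finset.sum_const_zero, add_zero]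
      rw [comulHom_eT, sum_fact_node g t (fun p => eT K p.1 ⊗ₜ[K] eW K p)]
      simp only [eT_leaf, eW_leaf]
      rfl
    · simp only [ha, if_false, Finset.sum_const_zero, zero_add]
      by_cases hb : ∃ α, a = node g α
      · obtain ⟨α, rfl⟩ := hb
        have hiff : ∀ y : Fin n → Term S, node g y = node g α ↔ ∀ i, y i = α i := by
          intro y; simp [funext_iff]
        have e1 : ∀ q : (∀ i, Factorization (t i)),
            (if (nodePair g fun i => (q i).1).1 = node g α then
              comulHom K (eW K (nodePair g fun i => (q i).1)) else 0) =
            (List.ofFn fun i => if (q i).1.1 = α i then comulHom K (eW K (q i).1) else 0).prod := by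
          intro q
          rw [prod_ofFn_ite, eW_nodePair, map_list_prod, List.map_ofFn]
          simp only [nodePair, hiff]
          rfl
        simp only [e1, hiff, ← prod_ofFn_ite]
        have e2 : ∀ q : (∀ i, Factorization (t i)),
            (∑ s : (∀ i, Factorization (q i).1.1), (List.ofFn fun i =>
              if (s i).1.1 = α i then eW K (s i).1 ⊗ₜ[K] eW K (q i).1 else 0).prod) =
            (List.ofFn fun i => ∑ s : Factorization (q i).1.1,
              if s.1.1 = α i then eW K s.1 ⊗ₜ[K] eW K (q i).1 else 0).prod := fun q =>
          (prod_ofFn_sum (fun i (s : Factorization (q i).1.1) =>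
            if s.1.1 = α i then eW K s.1 ⊗ₜ[K] eW K (q i).1 else 0)).symm
        simp only [e2]
        rw [← prod_ofFn_sum (fun i (p : Factorization (t i)) =>
          if p.1.1 = α i then comulHom K (eW K p.1) else 0),
          ← prod_ofFn_sum (fun i (p : Factorization (t i)) => ∑ q : Factorization p.1.1,
            if q.1.1 = α i then eW K q.1 ⊗ₜ[K] eW K p.1 else 0)]
        congr 2
        funext i
        exact ih i (α i)
      · have hne : ∀ y : Fin n → Term S, node g y ≠ a := fun y h => hb ⟨y, h.symm⟩
        simp [nodePair, hne]

theorem comul_coassoc :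
    (Algebra.TensorProduct.assoc K K K (NatHopf K S) (NatHopf K S) (NatHopf K S)).toAlgHom.comp
      ((Algebra.TensorProduct.map (comulHom K (S := S)) (.id K (NatHopf K S))).comp (comulHom K (S := S))) =
    (Algebra.TensorProduct.map (.id K (NatHopf K S)) (comulHom K (S := S))).comp (comulHom K (S := S)) := by
  classical
  refine algHom_ext_eT K fun x => ?_
  have h : (∑ p : Factorization x, Finsupp.single p.1.1 (comulHom K (eW K p.1))) =
      ∑ p : Factorization x, ∑ q : Factorization p.1.1,
        Finsupp.single q.1.1 (eW K q.1 ⊗ₜ[K] eW K p.1) := by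
    ext a
    have := coassoc_coord K x a
    simpa only [Finsupp.finsetSum_apply, Finsupp.single_apply] using this
  have h2 := congrArg (Finsupp.lsum K fun a : Term S =>
    TensorProduct.mk K (NatHopf K S) (NatHopf K S ⊗[K] NatHopf K S) (eT K a)) h
  simp only [map_sum, Finsupp.lsum_single, TensorProduct.mk_apply] at h2
  simp only [AlgHom.comp_apply, comulHom_eT, map_sum, Algebra.TensorProduct.map_tmul,
    TensorProduct.sum_tmul, AlgHom.id_apply, h2]
  rfl

theorem deg_eq_zero {t : Term S} : t.deg = 0 ↔ t = leaf := by
  cases t <;> simp [deg]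

theorem deg_graft (y : Term S) (w : Fin y.arity → Term S) :
    (y.graft w).deg = y.deg + ∑ k, (w k).deg := by
  induction y with
  | leaf =>
    simp only [graft, deg]
    exact ((zero_add _).trans (Fin.sum_univ_one fun k => (w k).deg)).symm
  | node g t ih =>
    simp only [graft, deg, ih, Finset.sum_add_distrib]
    rw [add_assoc]
    congr 2
    rw [← Fintype.sum_sigma']
    exact finSigmaFinEquiv.sum_comp (fun k => (w k).deg)

theorem graft_leaves (y : Term S) : (y.graft fun _ => leaf) = y := by
  induction y with
  | leaf => rfl
  | node g t ih => simp only [graft, ih]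

/-- The trivial factorization of `x` with all the lower terms equal to the leaf. -/
def trivFact (x : Term S) : Factorization x := ⟨⟨x, fun _ => leaf⟩, graft_leaves x⟩

theorem eq_trivFact {x : Term S} (p : Factorization x) (h : ∀ k, p.1.2 k = leaf) :
    p = trivFact x := by
  obtain ⟨⟨y, w⟩, rfl⟩ := p
  obtain rfl : w = fun _ => leaf := funext h
  refine Subtype.ext ?_
  simp only [trivFact]
  rw [graft_leaves]

theorem deg_fact {x : Term S} (p : Factorization x) :
    p.1.1.deg + ∑ k, (p.1.2 k).deg = x.deg := by
  rw [← deg_graft, p.2]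

theorem eq_trivFact_of_deg {x : Term S} (p : Factorization x) (h : x.deg ≤ p.1.1.deg) :
    p = trivFact x := by
  have := deg_fact p
  have h0 : ∑ k, (p.1.2 k).deg = 0 := by omega
  exact eq_trivFact p fun k => deg_eq_zero.1 (Finset.sum_eq_zero_iff.1 h0 k (Finset.mem_univ k))

theorem deg_lt_of_ne {x : Term S} (p : Factorization x) (h : p ≠ trivFact x) :
    p.1.1.deg < x.deg := by
  by_contra h'
  exact h (eq_trivFact_of_deg p (not_lt.1 h'))

theorem deg_lower_lt {x : Term S} (p : Factorization x) (h : p.1.1 ≠ leaf)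
    (k : Fin p.1.1.arity) : (p.1.2 k).deg < x.deg := by
  have h1 := deg_fact p
  have h2 := Finset.single_le_sum (f := fun k => (p.1.2 k).deg) (fun _ _ => Nat.zero_le _)
    (Finset.mem_univ k)
  have h3 : p.1.1.deg ≠ 0 := fun h' => h (deg_eq_zero.1 h')
  omega

theorem eW_trivFact (x : Term S) : eW K (trivFact x).1 = 1 := by
  rw [eW_eq]
  refine List.prod_eq_one fun a ha => ?_
  obtain ⟨k, rfl⟩ := (List.mem_ofFn' _ _).1 ha
  exact eT_leaf K

theorem counitHom_eT_of_ne {t : Term S} (h : t ≠ leaf) : counitHom K (eT K t) = 0 :=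
  liftE_eT K _ ⟨t, h⟩

theorem counitHom_eW_of_ne {x : Term S} {p : Factorization x} (h : p ≠ trivFact x) :
    counitHom K (eW K p.1) = 0 := by
  rw [eW_eq, map_list_prod, List.map_ofFn]
  obtain ⟨k, hk⟩ : ∃ k, p.1.2 k ≠ leaf := by
    by_contra hh
    push Not at hh
    exact h (eq_trivFact p hh)
  refine List.prod_eq_zero ((List.mem_ofFn' _ _).2 ⟨k, ?_⟩)
  exact counitHom_eT_of_ne K hk

theorem comul_counit_left :
    (Algebra.TensorProduct.map (counitHom K (S := S)) (.id K (NatHopf K S))).comp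
      (comulHom K (S := S)) = (Algebra.TensorProduct.lid K (NatHopf K S)).symm := by
  refine algHom_ext_eT K fun x => ?_
  have h : ∀ x : Term S, (Algebra.TensorProduct.lid K (NatHopf K S)).symm (eT K x) =
    1 ⊗ₜ eT K x := fun x => rfl
  refine Eq.trans ?_ (h x).symm
  simp only [AlgHom.comp_apply, comulHom_eT, map_sum, Algebra.TensorProduct.map_tmul,
    AlgHom.id_apply]
  cases x with
  | leaf =>
    rw [sum_fact_leaf (fun p => counitHom K (eT K p.1) ⊗ₜ[K] eW K p), eW_leaf, eT_leaf, map_one]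
  | node g t =>
    rw [sum_fact_node g t (fun p => counitHom K (eT K p.1) ⊗ₜ[K] eW K p), eW_leaf, eT_leaf,
      map_one, Finset.sum_eq_zero, add_zero]
    intro q _
    rw [counitHom_eT_of_ne K (by simp [nodePair]), TensorProduct.zero_tmul]

theorem comul_counit_right :
    (Algebra.TensorProduct.map (.id K (NatHopf K S)) (counitHom K (S := S))).comp
      (comulHom K (S := S)) = (Algebra.TensorProduct.rid K K (NatHopf K S)).symm := by
  refine algHom_ext_eT K fun x => ?_
  have h : ∀ x : Term S, (Algebra.TensorProduct.rid K K (NatHopf K S)).symm (eT K x) =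
    eT K x ⊗ₜ 1 := fun x => rfl
  refine Eq.trans ?_ (h x).symm
  simp only [AlgHom.comp_apply, comulHom_eT, map_sum, Algebra.TensorProduct.map_tmul,
    AlgHom.id_apply]
  rw [Finset.sum_eq_single (trivFact x)]
  · rw [eW_trivFact, map_one]; rfl
  · intro p _ hp
    rw [counitHom_eW_of_ne K hp, TensorProduct.tmul_zero]
  · simp

instance : Bialgebra K (NatHopf K S) :=
  Bialgebra.ofAlgHom (comulHom K) (counitHom K) (comul_coassoc K) (comul_counit_left K)
    (comul_counit_right K)

open scoped Classical in
/-- Values on terms of the left convolution inverse of the identity. -/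
def antiL (x : Term S) : NatHopf K S :=
  if x = leaf then 1 else
    -∑ p : Factorization x, if h : p = trivFact x then 0 else
      have : p.1.1.deg < x.deg := deg_lt_of_ne p h
      antiL p.1.1 * eW K p.1
termination_by x.deg

open scoped Classical in
/-- Values on terms of the right convolution inverse of the identity. -/
def antiR (x : Term S) : NatHopf K S :=
  if x = leaf then 1 else
    -∑ p : Factorization x, if h : p.1.1 = leaf then 0 else
      eT K p.1.1 * (List.ofFn fun k =>
        have : (p.1.2 k).deg < x.deg := deg_lower_lt p h k
        antiR (p.1.2 k)).reverse.prod
termination_by x.deg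

/-- The linear map reversing products with given values on terms. -/
def antiHom (s : Term S → NatHopf K S) : NatHopf K S →ₗ[K] NatHopf K S :=
  (MulOpposite.opLinearEquiv K).symm.toLinearMap ∘ₗ
    (liftE K fun x => MulOpposite.op (s x.1)).toLinearMap

theorem antiHom_one (s : Term S → NatHopf K S) : antiHom K s 1 = 1 := by
  simp [antiHom]

theorem antiHom_mul (s : Term S → NatHopf K S) (a b : NatHopf K S) :
    antiHom K s (a * b) = antiHom K s b * antiHom K s a := by
  simp [antiHom]

theorem antiHom_eT (s : Term S → NatHopf K S) (hs : s leaf = 1) (t : Term S) :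
    antiHom K s (eT K t) = s t := by
  by_cases h : t = leaf
  · rw [h, eT_leaf, antiHom_one, hs]
  · simpa [antiHom] using congrArg MulOpposite.unop
      (liftE_eT K (fun x => MulOpposite.op (s x.1)) ⟨t, h⟩)

theorem antiHom_prod (s : Term S → NatHopf K S) (l : List (NatHopf K S)) :
    antiHom K s l.prod = (l.map (antiHom K s)).reverse.prod := by
  induction l with
  | nil => simp [antiHom_one]
  | cons a l ih => simp [antiHom_mul, ih]

theorem antiL_leaf : antiL K (leaf : Term S) = 1 := by
  rw [antiL, if_pos rfl]

theorem antiR_leaf : antiR K (leaf : Term S) = 1 := by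
  rw [antiR, if_pos rfl]

theorem antiHom_eW (s : Term S → NatHopf K S) (hs : s leaf = 1)
    (p : Σ y : Term S, (Fin y.arity → Term S)) :
    antiHom K s (eW K p) = (List.ofFn fun k => s (p.2 k)).reverse.prod := by
  rw [eW_eq, antiHom_prod, List.map_ofFn]
  congr 3
  funext k
  exact antiHom_eT K s hs _

theorem induction_E {P : NatHopf K S → Prop} (hone : P 1) (hmul : ∀ t a, P a → P (eT K t * a))
    (hadd : ∀ a b, P a → P b → P (a + b)) (hsmul : ∀ (c : K) a, P a → P (c • a))
    (a : NatHopf K S) : P a := by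
  refine MonoidAlgebra.induction_on (motive := P) a (fun f => ?_) hadd hsmul
  change P (E K f)
  induction f using FreeMonoid.recOn with
  | one => rw [E_one]; exact hone
  | of_mul t f ih =>
    rw [E_mul, ← rd_of_ne]
    exact hmul _ _ ih

theorem mul_antiL : LinearMap.mul' K (NatHopf K S) ∘ₗ
    (antiHom K (antiL K)).rTensor (NatHopf K S) ∘ₗ Coalgebra.comul =
      Algebra.linearMap K (NatHopf K S) ∘ₗ Coalgebra.counit := by
  classical
  let M : NatHopf K S ⊗[K] NatHopf K S →ₗ[K] NatHopf K S :=
    LinearMap.mul' K (NatHopf K S) ∘ₗ (antiHom K (antiL K)).rTensor (NatHopf K S)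
  have hM : ∀ (z : NatHopf K S ⊗[K] NatHopf K S) (b b' : NatHopf K S),
      M (z * b ⊗ₜ b') = antiHom K (antiL K) b * M z * b' := by
    intro z b b'
    induction z using TensorProduct.induction_on with
    | zero => simp
    | tmul x y => simp [M, antiHom_mul, mul_assoc]
    | add x y hx hy => rw [add_mul, map_add, hx, hy, map_add, mul_add, add_mul]
  have hT : ∀ t : Term S, M (comulHom K (eT K t)) = algebraMap K _ (counitHom K (eT K t)) := by
    intro t
    by_cases h : t = leaf
    · subst h
      simp [eT_leaf, M, Algebra.TensorProduct.one_def, antiHom_one]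
    · rw [counitHom_eT_of_ne K h, map_zero, comulHom_eT, map_sum]
      simp only [M, LinearMap.comp_apply, LinearMap.rTensor_tmul, LinearMap.mul'_apply,
        antiHom_eT K _ (antiL_leaf K)]
      rw [← Finset.add_sum_erase _ _ (Finset.mem_univ (trivFact t)), eW_trivFact, mul_one]
      have h2 : antiL K (trivFact t).1.1 = antiL K t := rfl
      rw [h2, antiL, if_neg h, neg_add_eq_zero,
        ← Finset.add_sum_erase _ _ (Finset.mem_univ (trivFact t)), dif_pos rfl, zero_add]
      refine Finset.sum_congr rfl fun p hp => ?_
      rw [dif_neg (Finset.ne_of_mem_erase hp)]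
  have hmulz : ∀ (t : Term S) (z : NatHopf K S ⊗[K] NatHopf K S),
      M (comulHom K (eT K t) * z) = counitHom K (eT K t) • M z := by
    intro t z
    induction z using TensorProduct.induction_on with
    | zero => simp
    | tmul x y =>
      rw [hM, hT, ← Algebra.commutes, mul_assoc, ← Algebra.smul_def]; rfl
    | add x y hx hy => rw [mul_add, map_add, hx, hy, map_add, smul_add]
  refine LinearMap.ext fun a => ?_
  change M (comulHom K a) = algebraMap K _ (counitHom K a)
  induction a using induction_E K with
  | hone => simp [M, Algebra.TensorProduct.one_def, antiHom_one]
  | hmul t a ih => rw [map_mul, hmulz, ih, map_mul, map_mul, Algebra.smul_def]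
  | hadd a b ha hb => rw [map_add, map_add, ha, hb, map_add, map_add]
  | hsmul c a ha => rw [map_smul, map_smul, ha, map_smul, Algebra.smul_def, smul_eq_mul, map_mul]

theorem mul_antiR : LinearMap.mul' K (NatHopf K S) ∘ₗ
    (antiHom K (antiR K)).lTensor (NatHopf K S) ∘ₗ Coalgebra.comul =
      Algebra.linearMap K (NatHopf K S) ∘ₗ Coalgebra.counit := by
  classical
  let M : NatHopf K S ⊗[K] NatHopf K S →ₗ[K] NatHopf K S :=
    LinearMap.mul' K (NatHopf K S) ∘ₗ (antiHom K (antiR K)).lTensor (NatHopf K S)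
  have hM : ∀ (z : NatHopf K S ⊗[K] NatHopf K S) (b b' : NatHopf K S),
      M (b ⊗ₜ b' * z) = b * M z * antiHom K (antiR K) b' := by
    intro z b b'
    induction z using TensorProduct.induction_on with
    | zero => simp
    | tmul x y => simp [M, antiHom_mul, mul_assoc]
    | add x y hx hy => rw [mul_add, map_add, hx, hy, map_add, mul_add, add_mul]
  have hT : ∀ t : Term S, M (comulHom K (eT K t)) = algebraMap K _ (counitHom K (eT K t)) := by
    intro t
    cases t with
    | leaf => simp [eT_leaf, M, Algebra.TensorProduct.one_def, antiHom_one]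
    | node g t =>
      rw [counitHom_eT_of_ne K (t := node g t) nofun, map_zero, comulHom_eT, map_sum]
      simp only [M, LinearMap.comp_apply, LinearMap.lTensor_tmul, LinearMap.mul'_apply,
        antiHom_eW K _ (antiR_leaf K)]
      rw [sum_fact_node g t
        (fun p => eT K p.1 * (List.ofFn fun k => antiR K (p.2 k)).reverse.prod)]
      have h2 : eT K (leaf : Term S) * (List.ofFn fun _ : Fin (leaf : Term S).arity =>
          antiR K (node g t)).reverse.prod = antiR K (node g t) := by
        rw [eT_leaf, one_mul]
        simp [arity]
      rw [h2, antiR, if_neg nofun, neg_add_eq_zero,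
        sum_fact_node g t (fun p => if h : p.1 = leaf then 0 else
          eT K p.1 * (List.ofFn fun k => antiR K (p.2 k)).reverse.prod), dif_pos rfl, zero_add]
      refine Finset.sum_congr rfl fun p hp => ?_
      rw [dif_neg nofun]
  have hmulz : ∀ (a : NatHopf K S) (z : NatHopf K S ⊗[K] NatHopf K S),
      M (comulHom K a) = algebraMap K _ (counitHom K a) →
      M (z * comulHom K a) = counitHom K a • M z := by
    intro a z ha
    induction z using TensorProduct.induction_on with
    | zero => simp
    | tmul x y =>
      rw [hM, ha, ← Algebra.commutes, mul_assoc, ← Algebra.smul_def]; rfl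
    | add x y hx hy => rw [add_mul, map_add, hx, hy, map_add, smul_add]
  refine LinearMap.ext fun a => ?_
  change M (comulHom K a) = algebraMap K _ (counitHom K a)
  induction a using induction_E K with
  | hone => simp [M, Algebra.TensorProduct.one_def, antiHom_one]
  | hmul t a ih =>
    rw [map_mul, hmulz _ _ ih, hT, map_mul, map_mul, ← Algebra.commutes, Algebra.smul_def]
  | hadd a b ha hb => rw [map_add, map_add, ha, hb, map_add, map_add]
  | hsmul c a ha => rw [map_smul, map_smul, ha, map_smul, Algebra.smul_def, smul_eq_mul, map_mul]

theorem antiL_eq_antiR : antiHom K (antiL K (S := S)) = antiHom K (antiR K) := by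
  have h1 : WithConv.toConv (antiHom K (antiL K (S := S))) * WithConv.toConv LinearMap.id = 1 :=
    congrArg WithConv.toConv (mul_antiL K)
  have h2 : WithConv.toConv LinearMap.id * WithConv.toConv (antiHom K (antiR K (S := S))) = 1 :=
    congrArg WithConv.toConv (mul_antiR K)
  exact congrArg WithConv.ofConv (left_inv_eq_right_inv h1 h2)

/-- The natural Hopf algebra of the free operad on `S`. -/
instance : HopfAlgebra K (NatHopf K S) where
  antipode := antiHom K (antiL K)
  mul_antipode_rTensor_comul := mul_antiL K
  mul_antipode_lTensor_comul := by rw [antiL_eq_antiR]; exact mul_antiR K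

end Hopf

/-- The word of terms underlying a reduced forest. -/
def RForest.word (f : RForest S) : List (Term S) := f.toList.map Subtype.val

/-- The component of degree `n`, spanned by the reduced forests with `n` internal nodes. -/
def natGrading (n : ℕ) : Submodule K (NatHopf K S) :=
  Submodule.span K (E K '' {f | Forest.deg f.word = n})

/-! ### Polynomials on alphabets -/

/-- The `X`-polynomials: noncommutative polynomials with variables in `X`, with a possibly infinite
support but finite degree. A polynomial is given by the coefficients of the words on `X`. -/
def APoly (X : Type u) : Submodule K (List X → K) where
  carrier := {P | ∃ d : ℕ, ∀ w, d < w.length → P w = 0}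
  zero_mem' := ⟨0, fun _ _ => rfl⟩
  add_mem' := by
    rintro P Q ⟨d, hP⟩ ⟨d', hQ⟩
    refine ⟨max d d', fun w hw => ?_⟩
    rw [Pi.add_apply, hP w (lt_of_le_of_lt (le_max_left _ _) hw),
      hQ w (lt_of_le_of_lt (le_max_right _ _) hw), add_zero]
  smul_mem' := by
    rintro c P ⟨d, hP⟩
    exact ⟨d, fun w hw => by rw [Pi.smul_apply, hP w hw, smul_zero]⟩

/-- The polynomials that are homogeneous of degree `n`. -/
def APoly.homogeneous (X : Type u) (n : ℕ) : Submodule K (APoly K X) where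
  carrier := {P | ∀ w, w.length ≠ n → P.1 w = 0}
  zero_mem' := fun _ _ => rfl
  add_mem' := by
    intro P Q hP hQ w hw
    have h1 := hP w hw
    have h2 := hQ w hw
    simp [h1, h2]
  smul_mem' := by
    intro c P hP w hw
    have h1 := hP w hw
    simp [h1]

/-- The subword made of the letters of the left alphabet. -/
def leftWord {X Y : Type u} (w : List (X ⊕ Y)) : List X := w.filterMap Sum.getLeft?

/-- The subword made of the letters of the right alphabet. -/
def rightWord {X Y : Type u} (w : List (X ⊕ Y)) : List Y := w.filterMap Sum.getRight?

theorem finite_restrictions {X Y : Type u} (u : List X) (v : List Y) :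
    {w : List (X ⊕ Y) | leftWord w = u ∧ rightWord w = v}.Finite := by
  have hf : ({x | x ∈ u.map Sum.inl ++ v.map Sum.inr} : Set (X ⊕ Y)).Finite :=
    List.finite_toSet _
  have hlen : ∀ w : List (X ⊕ Y), w.length = (leftWord w).length + (rightWord w).length := by
    intro w
    induction w with
    | nil => rfl
    | cons a w ih => cases a <;> simp [leftWord, rightWord, List.filterMap_cons] at ih ⊢ <;> omega
  have hmem : ∀ (w : List (X ⊕ Y)), ∀ x ∈ w,
      x ∈ (leftWord w).map Sum.inl ++ (rightWord w).map Sum.inr := by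
    intro w x hx
    cases x <;> simp [leftWord, rightWord, hx]
  have := hf.to_subtype
  refine Set.Finite.subset ((List.finite_length_eq
    {x // x ∈ ({x | x ∈ u.map Sum.inl ++ v.map Sum.inr} : Set (X ⊕ Y))}
    (u.length + v.length)).image (List.map Subtype.val)) ?_
  rintro w ⟨rfl, rfl⟩
  refine ⟨w.attach.map fun x => ⟨x.1, hmem w x.1 x.2⟩, ?_, ?_⟩
  · simp [← hlen]
  · rw [List.map_map]
    exact List.attach_map_subtype_val w

/-- The map `θ`, sending a word `w` to `leftWord w ⊗ rightWord w` and extended to polynomials of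
infinite support. An element of the target is a possibly infinite linear combination of the
tensors `u ⊗ v`, given by its coefficients; each of them is a finite sum. -/
def theta (X Y : Type u) : APoly K (X ⊕ Y) →ₗ[K] (List X × List Y → K) where
  toFun P p := ∑ w ∈ (finite_restrictions p.1 p.2).toFinset, P.1 w
  map_add' P Q := by
    funext p
    simp [Finset.sum_add_distrib]
  map_smul' c P := by
    funext p
    simp [Finset.mul_sum]

/-- The canonical map from the tensor product of two spaces of polynomials to the possibly
infinite linear combinations of tensors `u ⊗ v` of words. It is injective
(`tensorEmb_injective`). -/
def tensorEmb (X Y : Type u) : APoly K X ⊗[K] APoly K Y →ₗ[K] (List X × List Y → K) :=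
  TensorProduct.lift <| LinearMap.mk₂ K (fun P Q p => P.1 p.1 * Q.1 p.2)
    (fun P P' Q => by funext p; simp [add_mul])
    (fun c P Q => by funext p; simp [mul_assoc])
    (fun P Q Q' => by funext p; simp [mul_add])
    (fun c P Q => by funext p; simp [mul_left_comm])

theorem tensorEmb_tmul (X Y : Type u) (P : APoly K X) (Q : APoly K Y) (u : List X) (v : List Y) :
    tensorEmb K X Y (P ⊗ₜ Q) (u, v) = P.1 u * Q.1 v := rfl

theorem tensorEmb_injective (X Y : Type u) : Function.Injective (tensorEmb K X Y) := by
  classical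
  rw [injective_iff_map_eq_zero]
  intro z hz
  let B := Module.Basis.ofVectorSpace K (APoly K Y)
  obtain ⟨b, rfl⟩ := (TensorProduct.equivFinsuppOfBasisRight (M := APoly K X) B).symm.surjective z
  suffices b = 0 by rw [this, map_zero]
  ext i u
  rw [TensorProduct.equivFinsuppOfBasisRight_symm_apply] at hz
  have h1 : (b.sum fun i m => m.1 u • B i) = 0 := by
    refine Subtype.ext (funext fun v => ?_)
    have := congrFun hz (u, v)
    simp only [Finsupp.sum, map_sum, Finset.sum_apply, tensorEmb_tmul] at this
    simpa [Finsupp.sum] using this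
  have h2 := linearIndependent_iff'.1 B.linearIndependent b.support (fun i => (b i).1 u) h1 i
  by_cases hi : i ∈ b.support
  · exact h2 hi
  · rw [Finsupp.notMem_support_iff.1 hi]; rfl

/-! ### Related alphabets and polynomial realizations -/

/-- The kind of a related alphabet: a family of relation symbols with positive arities. -/
structure RelKind : Type (u + 1) where
  Idx : Type u
  ar : Idx → ℕ
  ar_pos : ∀ i, 1 ≤ ar i

/-- The structures of related alphabet of kind `σ` on the set `X`: an `n`-ary relation for each
relation symbol of arity `n`. -/
abbrev RelStr (σ : RelKind.{u}) (X : Type u) : Type u := ∀ i : σ.Idx, Set (Fin (σ.ar i) → X)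

/-- Renaming of the letters. -/
def RelStr.map {σ : RelKind.{u}} {X Y : Type u} (e : X ≃ Y) (A : RelStr σ X) : RelStr σ Y :=
  fun i => {x | (fun k => e.symm (x k)) ∈ A i}

/-- Polynomial realizations of a Hopf algebra `H` with homogeneous components `G n`. The class
`C` of related alphabets is given by its members on each set `X`. The disjoint sum of two
alphabets on `X` and `Y` is an alphabet on the disjoint union `X ⊕ Y`; it is associative up to the
canonical identification of `(X ⊕ Y) ⊕ Z` with `X ⊕ (Y ⊕ Z)`. -/
structure IsPolynomialRealization {H : Type*} [Ring H] [HopfAlgebra K H]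
    (G : ℕ → Submodule K H) {σ : RelKind.{u}} (C : ∀ X : Type u, Set (RelStr σ X))
    (dsum : ∀ {X Y : Type u}, RelStr σ X → RelStr σ Y → RelStr σ (X ⊕ Y))
    (r : ∀ {X : Type u}, RelStr σ X → H →ₗ[K] APoly K X)
    {X₀ : Type u} (A₀ : RelStr σ X₀) : Prop where
  dsum_mem : ∀ {X Y : Type u} {A : RelStr σ X} {B : RelStr σ Y},
    A ∈ C X → B ∈ C Y → dsum A B ∈ C (X ⊕ Y)
  dsum_assoc : ∀ {X Y Z : Type u} {A : RelStr σ X} {B : RelStr σ Y} {D : RelStr σ Z},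
    A ∈ C X → B ∈ C Y → D ∈ C Z →
      (dsum (dsum A B) D).map (Equiv.sumAssoc X Y Z) = dsum A (dsum B D)
  graded : ∀ {X : Type u} {A : RelStr σ X}, A ∈ C X →
    ∀ n, ∀ x ∈ G n, r A x ∈ APoly.homogeneous K X n
  doubling : ∀ {X Y : Type u} {A : RelStr σ X} {B : RelStr σ Y}, A ∈ C X → B ∈ C Y →
    ∀ x : H, theta K X Y (r (dsum A B) x) =
      tensorEmb K X Y (TensorProduct.map (r A) (r B) (Coalgebra.comul x))
  mem : A₀ ∈ C X₀
  injective : Function.Injective (r A₀)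

/-! ### Forest-like alphabets -/

/-- The relation symbols of the forest-like alphabets: the root relation, a decoration relation for
each symbol and an edge relation for each `j ≥ 1`. -/
inductive ForestIdx (S : Signature.{u}) : Type u
  | root : ForestIdx S
  | deco (g : Symbol S) : ForestIdx S
  | edge (j : ℕ+) : ForestIdx S

/-- The kind of the forest-like alphabets: the root and decoration relations are unary, the edge
relations are binary. -/
abbrev forestKind (S : Signature.{u}) : RelKind.{u} where
  Idx := ForestIdx S
  ar
    | .root => 1
    | .deco _ => 1
    | .edge _ => 2
  ar_pos := by rintro (_ | _ | _) <;> simp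

/-- The `S`-forest-like alphabets on the set `X`. -/
abbrev ForestLike (S : Signature.{u}) (X : Type u) : Type u := RelStr (forestKind S) X

/-- The class of all `S`-forest-like alphabets. -/
def forestLikeClass (S : Signature.{u}) (X : Type u) : Set (RelStr (forestKind S) X) := Set.univ

namespace ForestLike

variable {X Y : Type u}

/-- The forest-like alphabet with the given relations. -/
def mk (R : X → Prop) (D : Symbol S → X → Prop) (T : ℕ+ → X → X → Prop) : ForestLike S X
  | .root => {x : Fin 1 → X | R (x 0)}
  | .deco g => {x : Fin 1 → X | D g (x 0)}
  | .edge j => {x : Fin 2 → X | T j (x 0) (x 1)}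

/-- The root relation. -/
def Root (A : ForestLike S X) (a : X) : Prop := ![a] ∈ A .root

/-- The decoration relations. -/
def Deco (A : ForestLike S X) (g : Symbol S) (a : X) : Prop := ![a] ∈ A (.deco g)

/-- The edge relations. -/
def Edge (A : ForestLike S X) (j : ℕ+) (a b : X) : Prop := ![a, b] ∈ A (.edge j)

/-- The disjoint sum of two forest-like alphabets. -/
def dsum (A : ForestLike S X) (B : ForestLike S Y) : ForestLike S (X ⊕ Y) :=
  mk (Sum.elim A.Root B.Root) (fun g => Sum.elim (A.Deco g) (B.Deco g))
    fun j a b => match a, b with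
      | .inl a, .inl b => A.Edge j a b
      | .inr a, .inr b => B.Edge j a b
      | .inl _, .inr b => B.Root b
      | .inr _, .inl _ => False

/-- The word `w` is `f`-compatible. -/
structure Compatible (A : ForestLike S X) (w : List X) (f : List (Term S)) : Prop where
  length_eq : w.length = Forest.deg f
  root : ∀ i (hi : i < w.length), Forest.IsRoot f i → A.Root w[i]
  deco : ∀ i (hi : i < w.length) g, Forest.Deco f i g → A.Deco g w[i]
  edge : ∀ i i' (hi : i < w.length) (hi' : i' < w.length) j, Forest.Edge f j i i' →
    A.Edge j w[i] w[i']

open scoped Classical in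
/-- The sum of all the `f`-compatible words. -/
def realizeForest (A : ForestLike S X) (f : RForest S) : APoly K X :=
  ⟨fun w => if A.Compatible w f.word then 1 else 0, Forest.deg f.word, fun w hw =>
    if_neg fun h => by have := h.length_eq; omega⟩

/-- The linear map sending `E f` to the sum of all the `f`-compatible words. -/
def realize (A : ForestLike S X) : NatHopf K S →ₗ[K] APoly K X :=
  Finsupp.linearCombination K (A.realizeForest K) ∘ₗ
    (MonoidAlgebra.coeffLinearEquiv K : MonoidAlgebra K (RForest S) ≃ₗ[K] _).toLinearMap

theorem realize_E (A : ForestLike S X) (f : RForest S) :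
    A.realize K (E K f) = A.realizeForest K f := by
  change Finsupp.linearCombination K (A.realizeForest K) (Finsupp.single f 1) = _
  rw [Finsupp.linearCombination_single, one_smul]

end ForestLike

/-- The letters `a_{g,u}`, for a symbol `g` and a word `u` of natural numbers. -/
abbrev Letter (S : Signature.{u}) : Type u := Symbol S × List ℕ

/-- The forest-like alphabet on the letters `a_{g,u}`. -/
def letterAlphabet (S : Signature.{u}) : ForestLike S (Letter S) :=
  ForestLike.mk (fun a => ∃ l, a.2 = List.replicate l 0) (fun g a => a.1 = g)
    fun j a b => ∃ l, b.2 = a.2 ++ (j : ℕ) :: List.replicate l 0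

end PolyReal

end

noncomputable section

open scoped TensorProduct

namespace PolyReal

universe u v

open Term

variable {S : Signature.{u}} {X Y : Type u}

/-! ### Compatibility by recursion on terms -/

/-! Everything rests on a recursive description of compatible words. A word compatible with a term
is a root letter followed by one block per child, and the block of the `j`-th child is compatible
with that child, except that its first letter is subject to "is joined by `→_j` to the root letter"
instead of the root relation. Hence `TermCompat`, which carries an arbitrary predicate `P` on the
root letter. `termCompatAt_iff` and `compatible_iff` identify it with the definition by preorder
positions. The grading is then the length condition in compatibility, and associativity of the sum
is a check on letters.

Injectivity: over the letters `a_{g,u}`, a word determines its reduced forest. Every letter below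
the `j`-th child of a node with address `u` has an address starting with `u j`, so blocks are
recovered by filtering on prefixes (`letter_termCompat_unique`). Since `j ≥ 1`, no such address is a
power of `0`, so the root letters mark where the terms of a forest begin
(`letter_compatible_unique`). Each forest has at least one compatible word
(`exists_letter_compatible`), and the coefficient of that word isolates the coefficient of the
forest.

Doubling: let a word over the sum be compatible with `t`. No edge goes from a right letter to a left
one, so the left letters form an upper part `y` of `t` containing the root, unless it is empty, and
the right letters fill the terms grafted on `y`. An edge from left to right requires exactly that
its target is a root on the right, so these grafted terms are realized independently as a forest.
Summing over `y` gives the coproduct (`splitHom_termPoly`). To use multiplicativity, the realization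
is cut down to finitely many letters, where it is an algebra morphism into a monoid algebra
(`wordHom`). The coefficient at a pair `(u, v)` only involves the letters of `u` and `v`, so nothing
is lost (`coeff_wordHom`, `theta_realize`). -/

theorem sum_Iio_succ {M : Type*} [AddCommMonoid M] {n : ℕ} (f : Fin (n + 1) → M) (i : Fin n) :
    ∑ k ∈ Finset.Iio i.succ, f k = f 0 + ∑ k ∈ Finset.Iio i, f k.succ := by
  have h : Finset.Iio i.succ = insert 0 ((Finset.Iio i).map (Fin.succEmb n)) := by
    ext k
    cases k using Fin.cases <;> simp
  rw [h, Finset.sum_insert (by simp), Finset.sum_map]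
  rfl

/-- The counterpart for words of `Term.start` and `Forest.offset`: when block lengths are degrees,
the sum of the earlier lengths is the shift used there to number internal nodes. -/
theorem getElem?_flatten_ofFn {α : Type*} {n : ℕ} (ws : Fin n → List α) (i : Fin n) {a : ℕ}
    (h : a < (ws i).length) :
    (List.ofFn ws).flatten[(∑ k ∈ Finset.Iio i, (ws k).length) + a]? = (ws i)[a]? := by
  induction n with
  | zero => exact i.elim0
  | succ n ih =>
    rw [List.ofFn_succ, List.flatten_cons]
    cases i using Fin.cases with
    | zero =>
      have h0 : Finset.Iio (0 : Fin (n + 1)) = ∅ := by ext k; simp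
      rw [h0, Finset.sum_empty, zero_add, List.getElem?_append_left h]
    | succ i =>
      rw [sum_Iio_succ, add_assoc, List.getElem?_append_right (Nat.le_add_right _ _),
        Nat.add_sub_cancel_left]
      exact ih (fun i => ws i.succ) i h

theorem length_flatten_ofFn {α : Type*} {n : ℕ} (ws : Fin n → List α) :
    (List.ofFn ws).flatten.length = ∑ i, (ws i).length := by
  rw [List.length_flatten, List.map_ofFn, List.sum_ofFn]
  rfl

theorem exists_eq_flatten_ofFn {α : Type*} {n : ℕ} (m : Fin n → ℕ) (w : List α)
    (h : w.length = ∑ i, m i) :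
    ∃ ws : Fin n → List α, w = (List.ofFn ws).flatten ∧ ∀ i, (ws i).length = m i := by
  induction n generalizing w with
  | zero => exact ⟨fun _ => [], by simpa using h, fun i => i.elim0⟩
  | succ n ih =>
    rw [Fin.sum_univ_succ] at h
    obtain ⟨ws, h1, h2⟩ := ih (fun i => m i.succ) (w.drop (m 0)) (by simp [h])
    refine ⟨Fin.cons (w.take (m 0)) ws, ?_, ?_⟩
    · simp [List.ofFn_succ, ← h1]
    · intro i
      cases i using Fin.cases with
      | zero => simp [h]
      | succ i => simpa using h2 i

theorem start_add_lt {n : ℕ} (g : S n) (t : Fin n → Term S) (i : Fin n) {a : ℕ}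
    (h : a < (t i).deg) : start t i + a < (node g t).deg := by
  have h2 := Finset.sum_le_univ_sum_of_nonneg (s := Finset.Iic i) (f := fun k => (t k).deg)
    fun _ => Nat.zero_le _
  rw [← Finset.Iio_insert, Finset.sum_insert (by simp)] at h2
  simp only [deg, start]
  omega

theorem deco_lt {t : Term S} {a : ℕ} {s : Symbol S} (h : t.Deco a s) : a < t.deg := by
  induction t generalizing a with
  | leaf => exact h.elim
  | node g t ih =>
    rcases h with ⟨rfl, -⟩ | ⟨i, a', h, rfl⟩
    · simp [deg]
    · exact start_add_lt g t i (ih i h)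

theorem edge_lt {t : Term S} {j : ℕ+} {a b : ℕ} (h : t.Edge j a b) : a < t.deg ∧ b < t.deg := by
  induction t generalizing a b with
  | leaf => exact h.elim
  | node g t ih =>
    rcases h with ⟨rfl, i, -, h, rfl⟩ | ⟨i, a', b', h, rfl, rfl⟩
    · exact ⟨by simp [deg], start_add_lt g t i (Nat.pos_of_ne_zero fun h' => h (deg_eq_zero.1 h'))⟩
    · exact ⟨start_add_lt g t i (ih i h).1, start_add_lt g t i (ih i h).2⟩

/-! ### Recursive and positional compatibility -/

namespace ForestLike

/-- The word `w` is compatible with the term `t`, the letter of the root being subject to `P`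
instead of the root relation. -/
def TermCompat (A : ForestLike S X) : Term S → (X → Prop) → List X → Prop
  | leaf, _, w => w = []
  | node (n := n) g t, P, w => ∃ (a : X) (ws : Fin n → List X),
      w = a :: (List.ofFn ws).flatten ∧ P a ∧ A.Deco ⟨n, g⟩ a ∧
        ∀ i, A.TermCompat (t i) (A.Edge (Nat.succPNat i) a) (ws i)

theorem TermCompat.length_eq {A : ForestLike S X} {t : Term S} {P : X → Prop} {w : List X}
    (h : A.TermCompat t P w) : w.length = t.deg := by
  induction t generalizing P w with
  | leaf => obtain rfl : w = [] := h; rfl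
  | node g t ih =>
    obtain ⟨a, ws, rfl, -, -, h⟩ := h
    rw [List.length_cons, length_flatten_ofFn, deg, add_comm]
    exact congrArg _ (Finset.sum_congr rfl fun i _ => ih i (h i))

/-- The description of `TermCompat` by the positions of the internal nodes. -/
structure TermCompatAt (A : ForestLike S X) (t : Term S) (P : X → Prop) (w : List X) : Prop where
  length_eq : w.length = t.deg
  root : t ≠ leaf → ∀ x, w[0]? = some x → P x
  deco : ∀ a s x, t.Deco a s → w[a]? = some x → A.Deco s x
  edge : ∀ j a b x y, t.Edge j a b → w[a]? = some x → w[b]? = some y → A.Edge j x y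

theorem getElem?_cons_start {n : ℕ} {t : Fin n → Term S} {ws : Fin n → List X}
    (h : ∀ i, (ws i).length = (t i).deg) (x : X) (i : Fin n) {a : ℕ} (ha : a < (t i).deg) :
    (x :: (List.ofFn ws).flatten)[start t i + a]? = (ws i)[a]? := by
  rw [← getElem?_flatten_ofFn ws i (by rw [h]; exact ha), start, add_assoc, add_comm 1,
    List.getElem?_cons_succ]
  simp only [h]

/-- Past the root, each decoration or edge condition lives inside one child and transfers to its
block by a shift of positions. What remains are the edges out of the root, and these become the
predicate imposed on the first letter of each child block. A leaf child has an empty block and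
imposes nothing. -/
theorem termCompatAt_iff {A : ForestLike S X} {t : Term S} {P : X → Prop} {w : List X} :
    A.TermCompatAt t P w ↔ A.TermCompat t P w := by
  induction t generalizing P w with
  | leaf =>
    constructor
    · intro h
      exact List.length_eq_zero_iff.1 h.length_eq
    · rintro rfl
      exact ⟨rfl, fun h => absurd rfl h, fun _ _ _ h => h.elim, fun _ _ _ _ _ h => h.elim⟩
  | @node n g t ih =>
    constructor
    · intro h
      obtain ⟨a, w, rfl⟩ := List.exists_cons_of_length_pos
        (show 0 < w.length by rw [h.length_eq]; simp [deg])
      obtain ⟨ws, rfl, hl⟩ := exists_eq_flatten_ofFn (fun i => (t i).deg) w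
        (by have := h.length_eq; simp only [List.length_cons, deg] at this; omega)
      refine ⟨a, ws, rfl, h.root nofun a rfl, h.deco 0 _ a (Or.inl ⟨rfl, rfl⟩) rfl, fun i =>
        (ih i).1 ⟨hl i, fun hi x hx => ?_, fun b s x hb hx => ?_, fun j b c x y hbc hx hy => ?_⟩⟩
      -- The first letter of the block of a nonleaf child sits at position `start t i`, the target
      -- of the edge leaving the root.
      · refine h.edge _ 0 (start t i) a x (Or.inl ⟨rfl, i, by simp, hi, rfl⟩) rfl ?_
        rw [← hx]
        exact getElem?_cons_start hl a i (a := 0)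
          (Nat.pos_of_ne_zero fun h' => hi (deg_eq_zero.1 h'))
      · refine h.deco (start t i + b) s x (Or.inr ⟨i, b, hb, rfl⟩) ?_
        rw [getElem?_cons_start hl a i (deco_lt hb), hx]
      · refine h.edge j (start t i + b) (start t i + c) x y (Or.inr ⟨i, b, c, hbc, rfl, rfl⟩) ?_ ?_
        · rw [getElem?_cons_start hl a i (edge_lt hbc).1, hx]
        · rw [getElem?_cons_start hl a i (edge_lt hbc).2, hy]
    · intro h
      have hlen := h.length_eq
      obtain ⟨a, ws, rfl, hP, hD, h⟩ := h
      have hl : ∀ i, (ws i).length = (t i).deg := fun i => (h i).length_eq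
      have h' := fun i => (ih i).2 (h i)
      refine ⟨hlen, fun _ x hx => ?_, fun b s x hb hx => ?_, fun j b c x y hbc hx hy => ?_⟩
      · obtain rfl : a = x := by simpa using hx
        exact hP
      · rcases hb with ⟨rfl, rfl⟩ | ⟨i, b, hb, rfl⟩
        · obtain rfl : a = x := by simpa using hx
          exact hD
        · rw [getElem?_cons_start hl a i (deco_lt hb)] at hx
          exact (h' i).deco b s x hb hx
      · rcases hbc with ⟨rfl, i, hj, hi, rfl⟩ | ⟨i, b, c, hbc, rfl, rfl⟩
        · obtain rfl : a = x := by simpa using hx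
          -- Children are indexed from `0` in `Fin n` but edges are labelled from `1`.
          obtain rfl : Nat.succPNat i = j := PNat.eq (by simpa using hj)
          refine (h' i).root hi y ?_
          rw [← hy]
          exact (getElem?_cons_start hl a i (a := 0)
            (Nat.pos_of_ne_zero fun h' => hi (deg_eq_zero.1 h'))).symm
        · rw [getElem?_cons_start hl a i (edge_lt hbc).1] at hx
          rw [getElem?_cons_start hl a i (edge_lt hbc).2] at hy
          exact (h' i).edge j b c x y hbc hx hy

/-- No condition relates two different terms of a forest, so compatibility splits along the blocks
of the terms, each with the root relation on its first letter. -/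
theorem compatible_iff {A : ForestLike S X} {w : List X} {f : List (Term S)} :
    A.Compatible w f ↔ ∃ ws : Fin f.length → List X, w = (List.ofFn ws).flatten ∧
      ∀ i, A.TermCompat (f.get i) A.Root (ws i) := by
  have hdeg : Forest.deg f = ∑ i, (f.get i).deg := by
    conv_lhs => rw [Forest.deg, ← List.ofFn_get f, List.map_ofFn, List.sum_ofFn]
    rfl
  have hget : ∀ {ws : Fin f.length → List X} (_ : ∀ i, (ws i).length = (f.get i).deg)
      (i : Fin f.length) {a : ℕ} (_ : a < (f.get i).deg),
      (List.ofFn ws).flatten[Forest.offset f i + a]? = (ws i)[a]? := by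
    intro ws h i a ha
    rw [← getElem?_flatten_ofFn ws i (by rw [h]; exact ha), Forest.offset]
    simp only [h]
  constructor
  · intro h
    obtain ⟨ws, rfl, hl⟩ := exists_eq_flatten_ofFn _ w (h.length_eq.trans hdeg)
    refine ⟨ws, rfl, fun i => termCompatAt_iff.1
      ⟨hl i, fun hi x hx => ?_, fun b s x hb hx => ?_, fun j b c x y hbc hx hy => ?_⟩⟩
    · have := hget hl i (a := 0) (Nat.pos_of_ne_zero fun h' => hi (deg_eq_zero.1 h'))
      rw [hx] at this
      obtain ⟨h1, rfl⟩ := List.getElem?_eq_some_iff.1 this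
      exact h.root _ h1 ⟨i, hi, rfl⟩
    · have := hget hl i (deco_lt hb)
      rw [hx] at this
      obtain ⟨h1, rfl⟩ := List.getElem?_eq_some_iff.1 this
      exact h.deco _ h1 _ ⟨i, b, hb, rfl⟩
    · have h1 := hget hl i (edge_lt hbc).1
      have h2 := hget hl i (edge_lt hbc).2
      rw [hx] at h1
      rw [hy] at h2
      obtain ⟨hb, rfl⟩ := List.getElem?_eq_some_iff.1 h1
      obtain ⟨hc, rfl⟩ := List.getElem?_eq_some_iff.1 h2
      exact h.edge _ _ hb hc _ ⟨i, b, c, hbc, rfl, rfl⟩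
  · rintro ⟨ws, rfl, h⟩
    have hl : ∀ i, (ws i).length = (f.get i).deg := fun i => (h i).length_eq
    have h' := fun i => termCompatAt_iff.2 (h i)
    refine ⟨?_, ?_, ?_, ?_⟩
    · rw [length_flatten_ofFn, hdeg]
      exact Finset.sum_congr rfl fun i _ => hl i
    · rintro _ hx ⟨i, hi, rfl⟩
      refine (h' i).root hi _ ?_
      rw [← List.getElem?_eq_getElem hx]
      exact (hget hl i (a := 0) (Nat.pos_of_ne_zero fun h' => hi (deg_eq_zero.1 h'))).symm
    · rintro _ hx g ⟨i, b, hb, rfl⟩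
      refine (h' i).deco b g _ hb ?_
      rw [← List.getElem?_eq_getElem hx, hget hl i (deco_lt hb)]
    · rintro _ _ hx hy j ⟨i, b, c, hbc, rfl, rfl⟩
      refine (h' i).edge j b c _ _ hbc ?_ ?_
      · rw [← List.getElem?_eq_getElem hx, hget hl i (edge_lt hbc).1]
      · rw [← List.getElem?_eq_getElem hy, hget hl i (edge_lt hbc).2]

theorem compatible_nil {A : ForestLike S X} {w : List X} : A.Compatible w [] ↔ w = [] := by
  rw [compatible_iff]
  constructor
  · rintro ⟨ws, rfl, -⟩
    rfl
  · rintro rfl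
    exact ⟨fun _ => [], rfl, fun i => i.elim0⟩

/-- The form suited to inductions on the forest. A leaf in the list takes the empty word, so
reducedness plays no role here. -/
theorem compatible_cons {A : ForestLike S X} {w : List X} {t : Term S} {f : List (Term S)} :
    A.Compatible w (t :: f) ↔
      ∃ w₁ w₂, w = w₁ ++ w₂ ∧ A.TermCompat t A.Root w₁ ∧ A.Compatible w₂ f := by
  simp only [compatible_iff]
  constructor
  · rintro ⟨ws, rfl, h⟩
    exact ⟨ws 0, _, by rw [List.ofFn_succ, List.flatten_cons], h 0, fun i => ws i.succ, rfl,
      fun i => h i.succ⟩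
  · rintro ⟨w₁, _, rfl, h₁, ws, rfl, h⟩
    refine ⟨Fin.cons w₁ ws, by simp [List.ofFn_succ], fun i => ?_⟩
    cases i using Fin.cases with
    | zero => exact h₁
    | succ i => exact h i

end ForestLike

variable (K : Type v) [Field K]

/-! ### Associativity of the disjoint sum, and grading -/

namespace ForestLike

/-- With either bracketing, an edge between two different summands goes from the earlier one to a
root of the later one, and never backwards. -/
theorem dsum_assoc {Z : Type u} (A : ForestLike S X) (B : ForestLike S Y) (D : ForestLike S Z) :
    ((A.dsum B).dsum D).map (Equiv.sumAssoc X Y Z) = A.dsum (B.dsum D) := by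
  funext i
  ext x
  cases i with
  | root =>
    change Sum.elim (A.dsum B).Root D.Root ((Equiv.sumAssoc X Y Z).symm (x 0)) ↔
      Sum.elim A.Root (B.dsum D).Root (x 0)
    rcases x 0 with a | b | d <;> rfl
  | deco g =>
    change Sum.elim ((A.dsum B).Deco g) (D.Deco g) ((Equiv.sumAssoc X Y Z).symm (x 0)) ↔
      Sum.elim (A.Deco g) ((B.dsum D).Deco g) (x 0)
    rcases x 0 with a | b | d <;> rfl
  | edge j =>
    change ((A.dsum B).dsum D).Edge j ((Equiv.sumAssoc X Y Z).symm (x 0))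
      ((Equiv.sumAssoc X Y Z).symm (x 1)) ↔ (A.dsum (B.dsum D)).Edge j (x 0) (x 1)
    rcases x 0 with a | b | d <;> rcases x 1 with a' | b' | d' <;> rfl

theorem realize_mem_homogeneous (A : ForestLike S X) (n : ℕ) {x : NatHopf K S}
    (hx : x ∈ natGrading K n) : A.realize K x ∈ APoly.homogeneous K X n := by
  have h : natGrading K n ≤ (APoly.homogeneous K X n).comap (A.realize K) := by
    refine Submodule.span_le.2 ?_
    rintro _ ⟨f, rfl, rfl⟩
    change A.realize K (E K f) ∈ APoly.homogeneous K X _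
    rw [realize_E]
    intro w hw
    exact if_neg fun h => hw h.length_eq
  exact h hx

end ForestLike

/-! ### Injectivity of the realization on the letters `a_{g,u}` -/

/-- If the predicates separate the blocks, each block can be read off the concatenation without
knowing where the cuts are. -/
theorem filter_flatten_ofFn {α : Type*} {n : ℕ} (ws : Fin n → List α) (p : Fin n → α → Bool)
    (h : ∀ i, ∀ x ∈ ws i, ∀ k, p k x = true ↔ k = i) (i : Fin n) :
    (List.ofFn ws).flatten.filter (p i) = ws i := by
  have key : ∀ k, (ws k).filter (p i) = if k = i then ws i else [] := by
    intro k
    split_ifs with hk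
    · subst hk
      exact List.filter_eq_self.2 fun x hx => (h k x hx k).2 rfl
    · exact List.filter_eq_nil_iff.2 fun x hx hp => hk ((h k x hx i).1 hp).symm
  rw [List.filter_flatten, List.map_ofFn]
  simp only [Function.comp_def, key]
  generalize ws i = l
  -- Only a concatenation of empty lists and one copy of `l` in place `i` is left, which an
  -- induction on `n` handles.
  clear h key ws p
  induction n with
  | zero => exact i.elim0
  | succ n ih =>
    rw [List.ofFn_succ, List.flatten_cons]
    cases i using Fin.cases with
    | zero => simp
    | succ i => simpa [(Fin.succ_ne_zero i).symm] using ih i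

/-- Following an edge only extends the address, so a prefix of the root address is inherited by all
descendants. -/
theorem letter_prefix {t : Term S} {P : Letter S → Prop} {w : List (Letter S)} {u : List ℕ}
    (hP : ∀ x, P x → u <+: x.2) (h : (letterAlphabet S).TermCompat t P w) :
    ∀ x ∈ w, u <+: x.2 := by
  induction t generalizing P w with
  | leaf => obtain rfl : w = [] := h; simp
  | node g t ih =>
    obtain ⟨a, ws, rfl, ha, -, h⟩ := h
    intro x hx
    rcases List.mem_cons.1 hx with rfl | hx
    · exact hP _ ha
    · obtain ⟨l, hl, hx⟩ := List.mem_flatten.1 hx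
      obtain ⟨i, rfl⟩ := (List.mem_ofFn' _ _).1 hl
      refine ih i ?_ (h i) x hx
      rintro y ⟨l, hy⟩
      replace hy : y.2 = _ := hy
      rw [hy]
      exact (hP a ha).trans (List.prefix_append _ _)

/-- The label of the first edge remains visible in every address below it, whatever zeros are
appended after it. -/
theorem letter_edge_prefix {t : Term S} {j : ℕ+} {a : Letter S} {w : List (Letter S)}
    (h : (letterAlphabet S).TermCompat t ((letterAlphabet S).Edge j a) w) :
    ∀ x ∈ w, a.2 ++ [(j : ℕ)] <+: x.2 := by
  refine letter_prefix ?_ h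
  rintro x ⟨l, hx⟩
  replace hx : x.2 = a.2 ++ (j : ℕ) :: List.replicate l 0 := hx
  rw [hx]
  exact ⟨List.replicate l 0, by simp⟩

/-- A word is compatible with at most one term. -/
theorem letter_termCompat_unique {t t' : Term S} {P P' : Letter S → Prop} {w : List (Letter S)}
    (h : (letterAlphabet S).TermCompat t P w) (h' : (letterAlphabet S).TermCompat t' P' w) :
    t = t' := by
  classical
  induction t generalizing t' P P' w with
  | leaf =>
    obtain rfl : w = [] := h
    exact (deg_eq_zero.1 h'.length_eq.symm).symm
  | @node n g t ih =>
    obtain ⟨a, ws, rfl, -, hg, h⟩ := h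
    cases t' with
    | leaf => exact absurd h' (List.cons_ne_nil _ _)
    | @node n' g' t' =>
      obtain ⟨a', ws', hw, -, hg', h'⟩ := h'
      obtain ⟨rfl, hw'⟩ := List.cons.inj hw
      -- The root letter carries its own decoration, so both terms have the same root symbol.
      have hs : (⟨n, g⟩ : Symbol S) = ⟨n', g'⟩ := Eq.trans (Eq.symm hg) hg'
      obtain ⟨rfl, hs⟩ := Sigma.mk.inj hs
      obtain rfl := eq_of_heq hs
      congr 1
      funext i
      -- The filter depends only on the root letter and on `i`, not on the term, so the two
      -- decompositions must have the same `i`-th block. The filters separate blocks because two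
      -- prefixes of one address with equal length coincide, which forces equal edge labels.
      have key : ∀ {t : Fin n → Term S} {ws : Fin n → List (Letter S)}
          (_ : ∀ i, (letterAlphabet S).TermCompat (t i)
            ((letterAlphabet S).Edge (Nat.succPNat i) a) (ws i)),
          (List.ofFn ws).flatten.filter (fun x => a.2 ++ [(i : ℕ) + 1] <+: x.2) = ws i := by
        intro t ws h
        refine filter_flatten_ofFn ws (fun i x => a.2 ++ [(i : ℕ) + 1] <+: x.2) ?_ i
        intro i x hx k
        have h1 := letter_edge_prefix (h i) x hx
        rw [decide_eq_true_iff]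
        constructor
        · intro h2
          have := (List.prefix_of_prefix_length_le h1 h2 (by simp)).eq_of_length (by simp)
          simp at this
          exact Fin.ext this.symm
        · rintro rfl
          simpa using h1
      have h1 := key h
      rw [hw', key h'] at h1
      refine ih i (h i) (P' := (letterAlphabet S).Edge (Nat.succPNat i) a) ?_
      have hcompat := h' i
      rwa [h1] at hcompat

/-- In a word compatible with a term, only the first letter satisfies the root relation. -/
theorem letter_root_unique {t : Term S} (ht : t ≠ leaf) {w : List (Letter S)}
    (h : (letterAlphabet S).TermCompat t (letterAlphabet S).Root w) :
    ∃ a w', w = a :: w' ∧ (letterAlphabet S).Root a ∧ ∀ x ∈ w', ¬ (letterAlphabet S).Root x := by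
  cases t with
  | leaf => exact absurd rfl ht
  | node g t =>
    obtain ⟨a, ws, rfl, ha, -, h⟩ := h
    refine ⟨a, _, rfl, ha, ?_⟩
    intro x hx ⟨l, hl⟩
    obtain ⟨l', hl', hx⟩ := List.mem_flatten.1 hx
    obtain ⟨i, rfl⟩ := (List.mem_ofFn' _ _).1 hl'
    have h1 := letter_edge_prefix (h i) x hx
    -- The address contains an edge label, which is at least `1`, whereas a root address consists of
    -- zeros.
    have h2 : ((Nat.succPNat i : ℕ+) : ℕ) ∈ x.2 := h1.subset (by simp)
    replace hl : x.2 = _ := hl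
    rw [hl] at h2
    simpa using List.eq_of_mem_replicate h2

/-- A word is compatible with at most one reduced forest. -/
theorem letter_compatible_unique {f f' : List (Term S)} (hf : ∀ t ∈ f, t ≠ leaf)
    (hf' : ∀ t ∈ f', t ≠ leaf) {w : List (Letter S)} (h : (letterAlphabet S).Compatible w f)
    (h' : (letterAlphabet S).Compatible w f') : f = f' := by
  classical
  induction f generalizing f' w with
  | nil =>
    obtain rfl := ForestLike.compatible_nil.1 h
    cases f' with
    | nil => rfl
    | cons t' f' =>
      obtain ⟨w₁, w₂, hw, h₁, -⟩ := ForestLike.compatible_cons.1 h'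
      obtain ⟨a, w', rfl, -⟩ := letter_root_unique (hf' t' (by simp)) h₁
      simp at hw
  | cons t f ih =>
    obtain ⟨w₁, w₂, rfl, h₁, h₂⟩ := ForestLike.compatible_cons.1 h
    cases f' with
    | nil =>
      obtain ⟨a, w', rfl, -⟩ := letter_root_unique (hf t (by simp)) h₁
      simp [ForestLike.compatible_nil] at h'
    | cons t' f' =>
      obtain ⟨w₁', w₂', hw, h₁', h₂'⟩ := ForestLike.compatible_cons.1 h'
      -- The rest of a forest is either empty or begins with a root letter, so the first term ends
      -- just before the next root letter.
      have key : ∀ {f : List (Term S)} (_ : ∀ t ∈ f, t ≠ leaf) {v w : List (Letter S)}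
          (_ : ∀ x ∈ v, ¬ (letterAlphabet S).Root x) (_ : (letterAlphabet S).Compatible w f),
          (v ++ w).takeWhile (fun x => ¬ (letterAlphabet S).Root x) = v := by
        intro f hf v w hv hw
        rw [List.takeWhile_append_of_pos (by simpa using hv)]
        cases f with
        | nil =>
          rw [ForestLike.compatible_nil.1 hw]
          simp
        | cons t f =>
          obtain ⟨w₁, w₂, rfl, h₁, -⟩ := ForestLike.compatible_cons.1 hw
          obtain ⟨a, w', rfl, ha, -⟩ := letter_root_unique (hf t (by simp)) h₁
          simp [ha]
      obtain ⟨a, w₃, rfl, -, hr⟩ := letter_root_unique (hf t (by simp)) h₁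
      obtain ⟨a', w₃', rfl, -, hr'⟩ := letter_root_unique (hf' t' (by simp)) h₁'
      obtain ⟨rfl, hw'⟩ := List.cons.inj hw
      replace hw' : w₃ ++ w₂ = w₃' ++ w₂' := hw'
      have hff : ∀ t ∈ f, t ≠ leaf := fun t ht => hf t (List.mem_cons_of_mem _ ht)
      have hff' : ∀ t ∈ f', t ≠ leaf := fun t ht => hf' t (List.mem_cons_of_mem _ ht)
      have h3 := key hff hr h₂
      rw [hw', key hff' hr' h₂'] at h3
      subst h3
      obtain rfl := List.append_cancel_left hw'
      have hfeq := ih hff hff' h₂ h₂'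
      rw [letter_termCompat_unique h₁ h₁', hfeq]

/-- The word compatible with a term obtained by labelling every internal node by its address,
starting from `u` at the root. -/
def addressWord : Term S → List ℕ → List (Letter S)
  | leaf, _ => []
  | node (n := n) g t, u =>
      (⟨n, g⟩, u) :: (List.ofFn fun i => addressWord (t i) (u ++ [(i : ℕ) + 1])).flatten

theorem termCompat_addressWord (t : Term S) {P : Letter S → Prop} {u : List ℕ}
    (hP : ∀ s, P (s, u)) : (letterAlphabet S).TermCompat t P (addressWord t u) := by
  induction t generalizing P u with
  | leaf => rfl
  | node g t ih =>
    exact ⟨_, _, rfl, hP _, rfl, fun i => ih i fun s => ⟨0, by simp⟩⟩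

theorem exists_letter_compatible (f : List (Term S)) :
    ∃ w, (letterAlphabet S).Compatible w f := by
  induction f with
  | nil => exact ⟨[], ForestLike.compatible_nil.2 rfl⟩
  | cons t f ih =>
    obtain ⟨w, hw⟩ := ih
    -- Every term may restart at the empty address, which is `0^0` and hence a root: different terms
    -- need not use different letters.
    exact ⟨_, ForestLike.compatible_cons.2 ⟨addressWord t [], w, rfl,
      termCompat_addressWord t fun s => ⟨0, rfl⟩, hw⟩⟩

theorem RForest.ne_leaf_of_mem_word {f : RForest S} {t : Term S} (h : t ∈ f.word) : t ≠ leaf := by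
  obtain ⟨s, -, rfl⟩ := List.mem_map.1 h
  exact s.2

theorem RForest.word_injective : Function.Injective (RForest.word (S := S)) := fun _ _ h =>
  FreeMonoid.toList.injective (List.map_injective_iff.2 Subtype.val_injective h)

/-- At a word compatible with `f`, all other reduced forests contribute zero, so the value of the
realization there is the coefficient of `f`. -/
theorem realize_letterAlphabet_injective :
    Function.Injective ((letterAlphabet S).realize K) := by
  classical
  rw [injective_iff_map_eq_zero]
  suffices H : ∀ x : MonoidAlgebra K (RForest S),
      Finsupp.linearCombination K ((letterAlphabet S).realizeForest K) x.coeff = 0 → x = 0 from H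
  intro x hx
  ext f
  obtain ⟨w, hw⟩ := exists_letter_compatible f.word
  have h := congrFun (congrArg Subtype.val hx) w
  rw [Finsupp.linearCombination_apply, Finsupp.sum, AddSubmonoidClass.coe_finsetSum,
    Finset.sum_apply,
    Finset.sum_eq_single f] at h
  · simpa [ForestLike.realizeForest, hw] using h
  · intro f' _ hne
    have : ¬ (letterAlphabet S).Compatible w f'.word := fun h' => hne <|
      RForest.word_injective <| letter_compatible_unique (fun _ => RForest.ne_leaf_of_mem_word)
        (fun _ => RForest.ne_leaf_of_mem_word) h' hw
    simp [ForestLike.realizeForest, this]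
  · intro hf
    simp [Finsupp.notMem_support_iff.1 hf]

/-! ### Realizations on finitely many letters -/

/-- As `F` is homogeneous of degree `m`, the only factorization of `w` that can contribute is the
cut after `m` letters. -/
theorem coeff_mul_of_length {F G : MonoidAlgebra K (FreeMonoid X)} {m : ℕ}
    (hF : ∀ w : List X, w.length ≠ m → F.coeff (FreeMonoid.ofList w) = 0) (w : List X) :
    (F * G).coeff (FreeMonoid.ofList w) =
      F.coeff (FreeMonoid.ofList (w.take m)) * G.coeff (FreeMonoid.ofList (w.drop m)) := by
  classical
  have key : ∀ a₁ a₂ : FreeMonoid X, F.coeff a₁ ≠ 0 → a₁ * a₂ = FreeMonoid.ofList w →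
      a₁ = FreeMonoid.ofList (w.take m) ∧ a₂ = FreeMonoid.ofList (w.drop m) := by
    intro a₁ a₂ h₁ h
    have hm : a₁.toList.length = m := by
      by_contra h'
      exact h₁ (hF a₁.toList h')
    have hw : w = a₁.toList ++ a₂.toList := congrArg FreeMonoid.toList h.symm
    subst hw hm
    simp
  rw [MonoidAlgebra.coeff_mul, Finsupp.sum, Finset.sum_eq_single (FreeMonoid.ofList (w.take m)),
    Finsupp.sum, Finset.sum_eq_single (FreeMonoid.ofList (w.drop m))]
  · rw [if_pos]
    rw [← FreeMonoid.ofList_append, List.take_append_drop]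
  · intro a _ ha
    by_cases h : F.coeff (FreeMonoid.ofList (w.take m)) = 0
    · simp [h]
    · exact if_neg fun h' => ha (key _ _ h h').2
  · intro h
    simp [Finsupp.notMem_support_iff.1 h]
  · intro a ha hne
    refine Finset.sum_eq_zero fun b _ => if_neg fun h => hne (key _ _ ?_ h).1
    exact Finsupp.mem_support_iff.1 ha
  · intro h
    simp [Finsupp.notMem_support_iff.1 h]

open scoped Classical in
-- Fixed lengths make the cutting into blocks unique, so no multiplicities appear and the product is
-- again a sum of distinct words.
theorem coeff_prod_ofFn {n : ℕ} (F : Fin n → MonoidAlgebra K (FreeMonoid X))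
    (U : Fin n → List X → Prop) (m : Fin n → ℕ) (hU : ∀ i w, U i w → w.length = m i)
    (hF : ∀ i w, (F i).coeff (FreeMonoid.ofList w) = if U i w then 1 else 0) (w : List X) :
    (List.ofFn F).prod.coeff (FreeMonoid.ofList w) =
      if ∃ ws : Fin n → List X, w = (List.ofFn ws).flatten ∧ ∀ i, U i (ws i) then 1 else 0 := by
  induction n generalizing w with
  | zero =>
    rw [List.ofFn_zero, List.prod_nil, MonoidAlgebra.one_def, MonoidAlgebra.coeff_single,
      Finsupp.single_apply]
    have h : (1 : FreeMonoid X) = FreeMonoid.ofList w ↔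
        ∃ ws : Fin 0 → List X, w = (List.ofFn ws).flatten ∧ ∀ i, U i (ws i) := by
      constructor
      · intro h
        exact ⟨fun _ => [], congrArg FreeMonoid.toList h.symm, fun i => i.elim0⟩
      · rintro ⟨ws, rfl, -⟩
        simp
    by_cases hw : (1 : FreeMonoid X) = FreeMonoid.ofList w
    · rw [if_pos hw, if_pos (h.1 hw)]
    · rw [if_neg hw, if_neg fun h' => hw (h.2 h')]
  | succ n ih =>
    rw [List.ofFn_succ, List.prod_cons, coeff_mul_of_length K (m := m 0), hF,
      ih (fun i => F i.succ) (fun i => U i.succ) (fun i => m i.succ) (fun i => hU i.succ)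
        (fun i => hF i.succ), ite_zero_mul_ite_zero, one_mul]
    · refine if_congr ?_ rfl rfl
      constructor
      · rintro ⟨h0, ws, hw, h⟩
        refine ⟨Fin.cons (w.take (m 0)) ws, by simp [List.ofFn_succ, ← hw], fun i => ?_⟩
        cases i using Fin.cases with
        | zero => exact h0
        | succ i => exact h i
      · rintro ⟨ws, rfl, h⟩
        rw [List.ofFn_succ, List.flatten_cons, ← hU 0 _ (h 0), List.take_left', List.drop_left']
        · exact ⟨h 0, _, rfl, fun i => h i.succ⟩
        · rfl
        · rfl
    · intro w hw
      rw [hF, if_neg fun h => hw (hU 0 w h)]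

theorem induction_basis {P : NatHopf K S → Prop} (basis : ∀ f, P (E K f))
    (hadd : ∀ a b, P a → P b → P (a + b)) (hsmul : ∀ (c : K) a, P a → P (c • a))
    (a : NatHopf K S) : P a :=
  MonoidAlgebra.induction_on (motive := P) a basis hadd hsmul

namespace ForestLike

open scoped Classical in
/-- The sum of the words with letters in the finite set `L` that are compatible with a term, the
letter of the root being subject to a given predicate. -/
def termPoly (A : ForestLike S X) (L : Finset X) :
    Term S → (X → Prop) → MonoidAlgebra K (FreeMonoid X)
  | leaf, _ => 1
  | node (n := n) g t, P => ∑ a ∈ L, if P a ∧ A.Deco ⟨n, g⟩ a then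
      MonoidAlgebra.of K _ (FreeMonoid.of a) *
        (List.ofFn fun i => termPoly A L (t i) (A.Edge (Nat.succPNat i) a)).prod else 0

theorem termPoly_leaf (A : ForestLike S X) (L : Finset X) (P : X → Prop) :
    A.termPoly K L leaf P = 1 := rfl

open scoped Classical in
theorem termPoly_node (A : ForestLike S X) (L : Finset X) {n : ℕ} (g : S n) (t : Fin n → Term S)
    (P : X → Prop) : A.termPoly K L (node g t) P =
      ∑ a ∈ L, if P a ∧ A.Deco ⟨n, g⟩ a then MonoidAlgebra.of K _ (FreeMonoid.of a) *
        (List.ofFn fun i => A.termPoly K L (t i) (A.Edge (Nat.succPNat i) a)).prod else 0 := rfl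

open scoped Classical in
-- The recursion of `termPoly` mirrors that of `TermCompat`. The first letter of the word selects
-- one summand, and the rest is cut into child blocks of prescribed lengths.
theorem coeff_termPoly (A : ForestLike S X) (L : Finset X) (t : Term S) (P : X → Prop)
    (w : List X) : (A.termPoly K L t P).coeff (FreeMonoid.ofList w) =
      if (∀ x ∈ w, x ∈ L) ∧ A.TermCompat t P w then 1 else 0 := by
  induction t generalizing P w with
  | leaf =>
    rw [termPoly_leaf, MonoidAlgebra.one_def, MonoidAlgebra.coeff_single, Finsupp.single_apply]
    refine if_congr ?_ rfl rfl
    constructor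
    · intro h
      obtain rfl : w = [] := congrArg FreeMonoid.toList h.symm
      exact ⟨by simp, rfl⟩
    · rintro ⟨-, rfl⟩
      rfl
  | @node n g t ih =>
    rw [termPoly_node, MonoidAlgebra.coeff_sum, Finsupp.finsetSum_apply]
    cases w with
    | nil =>
      rw [if_neg, Finset.sum_eq_zero]
      · intro a _
        split_ifs
        · refine MonoidAlgebra.coeff_single_mul_of_forall_mul_ne _ _ fun d h => ?_
          exact List.cons_ne_nil _ _ (congrArg FreeMonoid.toList h)
        · rfl
      · rintro ⟨-, a, ws, h, -⟩
        exact List.cons_ne_nil _ _ h.symm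
    | cons a w =>
      have hmul : ∀ b (F : MonoidAlgebra K (FreeMonoid X)),
          (MonoidAlgebra.of K _ (FreeMonoid.of b) * F).coeff (FreeMonoid.ofList (a :: w)) =
            if b = a then F.coeff (FreeMonoid.ofList w) else 0 := by
        intro b F
        split_ifs with h
        · subst h
          rw [FreeMonoid.ofList_cons, MonoidAlgebra.of_apply, MonoidAlgebra.coeff_single_mul_mul,
            one_mul]
        · refine MonoidAlgebra.coeff_single_mul_of_forall_mul_ne _ _ fun d h' => h ?_
          exact (List.cons.inj (congrArg FreeMonoid.toList h')).1
      have hterm : ∀ b, (if P b ∧ A.Deco ⟨n, g⟩ b then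
          MonoidAlgebra.of K _ (FreeMonoid.of b) * (List.ofFn fun i =>
            A.termPoly K L (t i) (A.Edge (Nat.succPNat i) b)).prod else 0).coeff
              (FreeMonoid.ofList (a :: w)) =
          if b = a then (if P a ∧ A.Deco ⟨n, g⟩ a then (List.ofFn fun i =>
            A.termPoly K L (t i) (A.Edge (Nat.succPNat i) a)).prod.coeff
              (FreeMonoid.ofList w) else 0) else 0 := by
        intro b
        by_cases hb : b = a
        · subst hb
          by_cases h : P b ∧ A.Deco ⟨n, g⟩ b
          · rw [if_pos h, hmul, if_pos rfl, if_pos rfl, if_pos h]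
          · rw [if_neg h, if_pos rfl, if_neg h]
            rfl
        · by_cases h : P b ∧ A.Deco ⟨n, g⟩ b
          · rw [if_pos h, hmul, if_neg hb, if_neg hb]
          · rw [if_neg h, if_neg hb]
            rfl
      rw [Finset.sum_congr rfl fun b _ => hterm b, Finset.sum_ite_eq',
        coeff_prod_ofFn K _ (fun i w => (∀ x ∈ w, x ∈ L) ∧
          A.TermCompat (t i) (A.Edge (Nat.succPNat i) a) w) (fun i => (t i).deg)
          (fun i w h => h.2.length_eq) (fun i w => by convert ih i _ w), ← ite_and, ← ite_and]
      refine if_congr ?_ rfl rfl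
      constructor
      · rintro ⟨⟨ha, hP, hD⟩, ws, rfl, h⟩
        refine ⟨?_, a, ws, rfl, hP, hD, fun i => (h i).2⟩
        intro x hx
        rcases List.mem_cons.1 hx with rfl | hx
        · exact ha
        · obtain ⟨l, hl, hx⟩ := List.mem_flatten.1 hx
          obtain ⟨i, rfl⟩ := (List.mem_ofFn' _ _).1 hl
          exact (h i).1 x hx
      · rintro ⟨hL, a', ws, h', hP, hD, h⟩
        obtain ⟨rfl, rfl⟩ := List.cons.inj h'
        refine ⟨⟨hL a (by simp), hP, hD⟩, ws, rfl, fun i => ⟨fun x hx => hL x ?_, h i⟩⟩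
        exact List.mem_cons_of_mem _
          (List.mem_flatten.2 ⟨_, (List.mem_ofFn' _ _).2 ⟨i, rfl⟩, hx⟩)

/-- The realization restricted to the finite set `L` of letters. -/
def wordHom (A : ForestLike S X) (L : Finset X) :
    NatHopf K S →ₐ[K] MonoidAlgebra K (FreeMonoid X) :=
  liftE K fun t => A.termPoly K L t.1 A.Root

theorem wordHom_eT (A : ForestLike S X) (L : Finset X) (t : Term S) :
    A.wordHom K L (eT K t) = A.termPoly K L t A.Root := by
  by_cases h : t = leaf
  · rw [h, eT_leaf, map_one, termPoly_leaf]
  · exact liftE_eT K _ ⟨t, h⟩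

open scoped Classical in
theorem coeff_wordHom_E (A : ForestLike S X) (L : Finset X) (f : RForest S) (w : List X) :
    (A.wordHom K L (E K f)).coeff (FreeMonoid.ofList w) =
      if (∀ x ∈ w, x ∈ L) ∧ A.Compatible w f.word then 1 else 0 := by
  induction f using FreeMonoid.recOn generalizing w with
  | one =>
    rw [E_one, map_one, MonoidAlgebra.one_def, MonoidAlgebra.coeff_single, Finsupp.single_apply]
    refine if_congr ?_ rfl rfl
    change _ ↔ _ ∧ A.Compatible w []
    rw [compatible_nil]
    constructor
    · intro h
      obtain rfl : w = [] := congrArg FreeMonoid.toList h.symm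
      exact ⟨by simp, rfl⟩
    · rintro ⟨-, rfl⟩
      rfl
  | of_mul t f ih =>
    have h0 : E K (FreeMonoid.of t) = eT K t.1 := by rw [eT, rd_of_ne]
    have hc := coeff_termPoly K A L t.1 A.Root
    rw [E_mul, map_mul, h0, wordHom_eT, coeff_mul_of_length K (m := t.1.deg), ih, hc,
      ite_zero_mul_ite_zero, one_mul]
    · refine if_congr ?_ rfl rfl
      change _ ↔ _ ∧ A.Compatible w (t.1 :: RForest.word f)
      rw [compatible_cons]
      constructor
      · rintro ⟨⟨h1, h2⟩, h3, h4⟩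
        refine ⟨fun x hx => ?_, _, _, (List.take_append_drop _ _).symm, h2, h4⟩
        rw [← List.take_append_drop t.1.deg w] at hx
        exact (List.mem_append.1 hx).elim (h1 x) (h3 x)
      · rintro ⟨hL, w₁, w₂, rfl, h1, h2⟩
        rw [← h1.length_eq, List.take_left', List.drop_left']
        · exact ⟨⟨fun x hx => hL x (List.mem_append_left _ hx), h1⟩,
            fun x hx => hL x (List.mem_append_right _ hx), h2⟩
        · rfl
        · rfl
    · intro w hw
      rw [hc, if_neg fun h => hw h.2.length_eq]

/-- The bridge to the finite setting: each coefficient of the full realization can be computed in a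
monoid algebra, with any finite set containing the letters of the word. -/
theorem coeff_wordHom (A : ForestLike S X) (L : Finset X) {w : List X} (hw : ∀ x ∈ w, x ∈ L)
    (x : NatHopf K S) :
    (A.wordHom K L x).coeff (FreeMonoid.ofList w) = (A.realize K x).1 w := by
  classical
  induction x using induction_basis K with
  | basis f => rw [coeff_wordHom_E, realize_E]; exact if_congr (and_iff_right hw) rfl rfl
  | hadd a b ha hb => rw [map_add, map_add]; exact congrArg₂ (· + ·) ha hb
  | hsmul c a ha => rw [map_smul, map_smul]; exact congrArg (c * ·) ha

end ForestLike

/-! ### The alphabet doubling trick -/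

/-- The monoid morphism sending a word to its subwords of left and of right letters. -/
def splitWord (X Y : Type u) : FreeMonoid (X ⊕ Y) →* FreeMonoid X × FreeMonoid Y :=
  FreeMonoid.lift (Sum.elim (fun a => (FreeMonoid.of a, 1)) fun b => (1, FreeMonoid.of b))

theorem splitWord_ofList (w : List (X ⊕ Y)) : splitWord X Y (FreeMonoid.ofList w) =
    (FreeMonoid.ofList (leftWord w), FreeMonoid.ofList (rightWord w)) := by
  induction w with
  | nil => rfl
  | cons a w ih =>
    rw [FreeMonoid.ofList_cons, map_mul, ih]
    cases a <;> rfl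

/-- The linear extension of `splitWord`. -/
def splitHom (X Y : Type u) : MonoidAlgebra K (FreeMonoid (X ⊕ Y)) →ₐ[K]
    MonoidAlgebra K (FreeMonoid X × FreeMonoid Y) :=
  MonoidAlgebra.mapDomainAlgHom K K (splitWord X Y)

/-- The tensor product of two noncommutative polynomials as a combination of pairs of words. -/
def pairHom (X Y : Type u) :
    MonoidAlgebra K (FreeMonoid X) ⊗[K] MonoidAlgebra K (FreeMonoid Y) →ₐ[K]
      MonoidAlgebra K (FreeMonoid X × FreeMonoid Y) :=
  Algebra.TensorProduct.lift
    (MonoidAlgebra.mapDomainAlgHom K K (MonoidHom.inl (FreeMonoid X) (FreeMonoid Y)))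
    (MonoidAlgebra.mapDomainAlgHom K K (MonoidHom.inr (FreeMonoid X) (FreeMonoid Y)))
    -- The two images commute because words of the left and of the right factor commute in the
    -- product monoid.
    fun F G => by
      induction F using MonoidAlgebra.induction_on with
      | of u =>
        induction G using MonoidAlgebra.induction_on with
        | of v => simp [Commute, SemiconjBy, MonoidAlgebra.single_mul_single]
        | add G G' h h' => rw [map_add]; exact h.add_right h'
        | smul c G h => rw [map_smul]; exact h.smul_right c
      | add F F' h h' => rw [map_add]; exact h.add_left h'
      | smul c F h => rw [map_smul]; exact h.smul_left c

theorem splitHom_of (w : FreeMonoid (X ⊕ Y)) :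
    splitHom K X Y (MonoidAlgebra.of K _ w) = MonoidAlgebra.of K _ (splitWord X Y w) := by
  simp [splitHom]

theorem pairHom_of (u : FreeMonoid X) (v : FreeMonoid Y) :
    pairHom K X Y (MonoidAlgebra.of K _ u ⊗ₜ MonoidAlgebra.of K _ v) =
      MonoidAlgebra.of K _ (u, v) := by
  simp [pairHom, MonoidAlgebra.single_mul_single]

/-- The finitely supported counterpart of `theta`: the same sum over the words with given left and
right subwords. -/
theorem coeff_splitHom (F : MonoidAlgebra K (FreeMonoid (X ⊕ Y))) (u : List X) (v : List Y) :
    (splitHom K X Y F).coeff (FreeMonoid.ofList u, FreeMonoid.ofList v) =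
      ∑ w ∈ (finite_restrictions u v).toFinset, F.coeff (FreeMonoid.ofList w) := by
  classical
  induction F using MonoidAlgebra.induction_on with
  | of w =>
    rw [splitHom_of]
    obtain ⟨w, rfl⟩ := FreeMonoid.ofList.surjective w
    rw [splitWord_ofList]
    simp only [MonoidAlgebra.of_apply, MonoidAlgebra.coeff_single, Finsupp.single_apply,
      EmbeddingLike.apply_eq_iff_eq, Prod.mk.injEq, Finset.sum_ite_eq, Set.Finite.mem_toFinset,
      Set.mem_ofPred_eq]
  | add F G hF hG =>
    rw [map_add, MonoidAlgebra.coeff_add, Finsupp.add_apply, hF, hG, ← Finset.sum_add_distrib]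
    rfl
  | smul c F hF =>
    rw [map_smul, MonoidAlgebra.coeff_smul_apply, hF, Finset.smul_sum]
    rfl

/-- The finitely supported counterpart of `tensorEmb`. -/
theorem coeff_pairHom_tmul (F : MonoidAlgebra K (FreeMonoid X)) (G : MonoidAlgebra K (FreeMonoid Y))
    (u : FreeMonoid X) (v : FreeMonoid Y) :
    (pairHom K X Y (F ⊗ₜ G)).coeff (u, v) = F.coeff u * G.coeff v := by
  classical
  induction F using MonoidAlgebra.induction_on with
  | of u' =>
    induction G using MonoidAlgebra.induction_on with
    | of v' =>
      rw [pairHom_of]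
      simp only [MonoidAlgebra.of_apply, MonoidAlgebra.coeff_single, Finsupp.single_apply,
        Prod.mk.injEq, ite_zero_mul_ite_zero, one_mul]
    | add G G' h h' =>
      rw [TensorProduct.tmul_add, map_add, MonoidAlgebra.coeff_add, Finsupp.add_apply, h, h',
        ← mul_add]
      rfl
    | smul c G h =>
      rw [TensorProduct.tmul_smul, map_smul, MonoidAlgebra.coeff_smul_apply, h,
        MonoidAlgebra.coeff_smul_apply, smul_eq_mul, smul_eq_mul, mul_left_comm]
  | add F F' h h' =>
    rw [TensorProduct.add_tmul, map_add, MonoidAlgebra.coeff_add, Finsupp.add_apply, h, h',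
      ← add_mul]
    rfl
  | smul c F h =>
    rw [← TensorProduct.smul_tmul', map_smul, MonoidAlgebra.coeff_smul_apply, h,
      MonoidAlgebra.coeff_smul_apply, smul_eq_mul, smul_eq_mul, mul_assoc]

/-! ### Splitting compatible words according to the coproduct -/

namespace ForestLike

variable (A : ForestLike S X) (B : ForestLike S Y) (L : Finset X) (M : Finset Y)

/-- A word of the disjoint sum whose first letter is on the right has no letter on the left. -/
theorem splitHom_termPoly_right (t : Term S) {P : X ⊕ Y → Prop} (hP : ∀ a, ¬ P (Sum.inl a)) :
    splitHom K X Y ((A.dsum B).termPoly K (L.disjSum M) t P) =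
      pairHom K X Y (1 ⊗ₜ B.termPoly K M t fun b => P (Sum.inr b)) := by
  classical
  induction t generalizing P with
  | leaf => rw [termPoly_leaf, termPoly_leaf, map_one, ← Algebra.TensorProduct.one_def, map_one]
  | @node n g t ih =>
    simp only [termPoly_node, Finset.sum_disjSum, hP, false_and, if_false, Finset.sum_const_zero,
      zero_add, map_sum, TensorProduct.tmul_sum]
    refine Finset.sum_congr rfl fun b _ => ?_
    change splitHom K X Y (if P (Sum.inr b) ∧ B.Deco ⟨n, g⟩ b then _ else _) = _
    split_ifs with h
    · have h1 : (1 : MonoidAlgebra K (FreeMonoid X)) ⊗ₜ[K]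
          (MonoidAlgebra.of K _ (FreeMonoid.of b) * (List.ofFn fun i =>
            B.termPoly K M (t i) (B.Edge (Nat.succPNat i) b)).prod) =
          (1 ⊗ₜ MonoidAlgebra.of K _ (FreeMonoid.of b)) * (List.ofFn fun i =>
            (1 : MonoidAlgebra K (FreeMonoid X)) ⊗ₜ[K]
              B.termPoly K M (t i) (B.Edge (Nat.succPNat i) b)).prod := by
        rw [← prod_ofFn_tmul, Algebra.TensorProduct.tmul_mul_tmul, one_mul]
        simp
      rw [h1, map_mul, map_mul, map_list_prod, map_list_prod, List.map_ofFn, List.map_ofFn]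
      congr 1
      · rw [splitHom_of, ← map_one (MonoidAlgebra.of K (FreeMonoid X)), pairHom_of]
        rfl
      · congr 2
        funext i
        -- An edge from a right letter to a left letter is `False` by definition of the sum, so the
        -- hypothesis on `P` passes to the children.
        exact ih i fun a h => h
    · rw [map_zero, TensorProduct.tmul_zero, map_zero]

/-- Sort the words by their root letter. If it is on the right, the whole word is, which is the
factorization with upper term `leaf`. If it is on the left, the upper term keeps the root symbol and
the children factorize independently. The hypothesis on `P` is what makes the induction close: it
holds for `B.Root` and for edges leaving a left letter alike. -/
theorem splitHom_termPoly (t : Term S) {P : X ⊕ Y → Prop}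
    (hP : ∀ b, P (Sum.inr b) ↔ B.Root b) :
    splitHom K X Y ((A.dsum B).termPoly K (L.disjSum M) t P) =
      pairHom K X Y (∑ p : Factorization t,
        A.termPoly K L p.1.1 (fun a => P (Sum.inl a)) ⊗ₜ B.wordHom K M (eW K p.1)) := by
  classical
  induction t generalizing P with
  | leaf =>
    rw [sum_fact_leaf (fun p => A.termPoly K L p.1 (fun a => P (Sum.inl a)) ⊗ₜ[K]
      B.wordHom K M (eW K p)), eW_leaf, eT_leaf, map_one]
    rw [termPoly_leaf, termPoly_leaf, map_one, ← Algebra.TensorProduct.one_def, map_one]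
  | @node n g t ih =>
    rw [sum_fact_node g t (fun p => A.termPoly K L p.1 (fun a => P (Sum.inl a)) ⊗ₜ[K]
      B.wordHom K M (eW K p)), eW_leaf, wordHom_eT, map_add, add_comm,
      termPoly_node, Finset.sum_disjSum, map_add]
    congr 1
    -- Left root letter: expanding over it turns the term of each tuple of factorizations into a
    -- product over the children.
    · have hq : ∀ q : (∀ i, Factorization (t i)),
          A.termPoly K L (nodePair g fun i => (q i).1).1 (fun a => P (Sum.inl a)) ⊗ₜ[K]
            B.wordHom K M (eW K (nodePair g fun i => (q i).1)) =
          ∑ a ∈ L, if P (Sum.inl a) ∧ A.Deco ⟨n, g⟩ a then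
            (MonoidAlgebra.of K _ (FreeMonoid.of a) ⊗ₜ[K] 1) * (List.ofFn fun i =>
              A.termPoly K L (q i).1.1 (A.Edge (Nat.succPNat i) a) ⊗ₜ[K]
                B.wordHom K M (eW K (q i).1)).prod else 0 := by
        intro q
        rw [eW_nodePair, map_list_prod, List.map_ofFn, nodePair, termPoly_node,
          TensorProduct.sum_tmul]
        refine Finset.sum_congr rfl fun a _ => ?_
        split_ifs
        · rw [← prod_ofFn_tmul, Algebra.TensorProduct.tmul_mul_tmul, one_mul]
          rfl
        · exact TensorProduct.zero_tmul _ _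
      -- With the root letter fixed first, the sum over tuples of factorizations becomes a product
      -- of sums, one for each child.
      rw [Finset.sum_congr rfl fun q _ => hq q, Finset.sum_comm, map_sum, map_sum]
      refine Finset.sum_congr rfl fun a _ => ?_
      change splitHom K X Y (if P (Sum.inl a) ∧ A.Deco ⟨n, g⟩ a then _ else _) = _
      split_ifs
      · rw [← Finset.mul_sum, ← prod_ofFn_sum (fun i (p : Factorization (t i)) =>
            A.termPoly K L p.1.1 (A.Edge (Nat.succPNat i) a) ⊗ₜ[K] B.wordHom K M (eW K p.1)),
          map_mul, map_mul, map_list_prod, map_list_prod, List.map_ofFn, List.map_ofFn]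
        congr 1
        · rw [splitHom_of, ← map_one (MonoidAlgebra.of K (FreeMonoid Y)), pairHom_of]
          rfl
        · congr 2
          funext i
          -- An edge from a left letter to the right letter `b` means `B.Root b` by definition of
          -- the sum.
          exact ih i fun b => Iff.rfl
      · rw [map_zero, Finset.sum_const_zero, map_zero]
    -- Right root letter: replacing `P` by a predicate that is false on the left discards the left
    -- root letters and, by `hP`, changes nothing on the right.
    · have h0 := splitHom_termPoly_right K A B L M (node g t)
        (P := Sum.elim (fun _ => False) B.Root) (fun _ h => h)
      refine Eq.trans ?_ h0
      rw [termPoly_node, Finset.sum_disjSum]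
      simp only [Sum.elim_inl, Sum.elim_inr, false_and, if_false, Finset.sum_const_zero, zero_add,
        hP]
      congr!

/-- Both sides are algebra morphisms in `x`, so single terms suffice. There `splitHom_termPoly`
applies with the root relation of the sum, which restricts to `B.Root` on the right. -/
theorem splitHom_wordHom (x : NatHopf K S) :
    splitHom K X Y ((A.dsum B).wordHom K (L.disjSum M) x) =
      pairHom K X Y (TensorProduct.map (A.wordHom K L).toLinearMap (B.wordHom K M).toLinearMap
        (Coalgebra.comul x)) := by
  have h : (splitHom K X Y).comp ((A.dsum B).wordHom K (L.disjSum M)) =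
      (pairHom K X Y).comp ((Algebra.TensorProduct.map (A.wordHom K L) (B.wordHom K M)).comp
        (comulHom K)) := by
    refine algHom_ext_eT K fun t => ?_
    simp only [AlgHom.comp_apply, wordHom_eT, comulHom_eT]
    rw [splitHom_termPoly K A B L M t (fun b => Iff.rfl)]
    simp only [map_sum, Algebra.TensorProduct.map_tmul, wordHom_eT]
    rfl
  exact DFunLike.congr_fun h x

theorem theta_realize (x : NatHopf K S) : theta K X Y ((A.dsum B).realize K x) =
    tensorEmb K X Y (TensorProduct.map (A.realize K) (B.realize K) (Coalgebra.comul x)) := by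
  classical
  funext ⟨u, v⟩
  -- The letters of `u` and `v` are enough: a word with these subwords uses no others.
  have h := congrArg (fun F => F.coeff (FreeMonoid.ofList u, FreeMonoid.ofList v))
    (splitHom_wordHom K A B u.toFinset v.toFinset x)
  simp only [coeff_splitHom] at h
  have h1 : theta K X Y ((A.dsum B).realize K x) (u, v) =
      ∑ w ∈ (finite_restrictions u v).toFinset, ((A.dsum B).realize K x).1 w := rfl
  rw [h1]
  refine Eq.trans (Finset.sum_congr rfl fun w hw => ?_) (h.trans ?_)
  · refine (coeff_wordHom K _ _ (fun z hz => ?_) x).symm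
    obtain ⟨rfl, rfl⟩ := (Set.Finite.mem_toFinset _).1 hw
    cases z <;> simp [leftWord, rightWord, hz]
  -- Both sides are additive in the coproduct, so it may be replaced by an arbitrary tensor and then
  -- by a pure one.
  · induction (Coalgebra.comul x : NatHopf K S ⊗[K] NatHopf K S) using
      TensorProduct.induction_on with
    | zero => simp
    | tmul a b =>
      simp only [TensorProduct.map_tmul, coeff_pairHom_tmul, tensorEmb_tmul,
        AlgHom.toLinearMap_apply]
      rw [coeff_wordHom K A _ (by simp), coeff_wordHom K B _ (by simp)]
    | add a b ha hb =>
      simp only [map_add, MonoidAlgebra.coeff_add, Finsupp.add_apply, Pi.add_apply, ha, hb]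

end ForestLike

end PolyReal

end

/-! ### The polynomial realization -/

theorem mainTheorem1 (K : Type*) [Field K] [CharZero K] (S : PolyReal.Signature) :
    PolyReal.IsPolynomialRealization (H := PolyReal.NatHopf K S) K (PolyReal.natGrading K)
      (PolyReal.forestLikeClass S) PolyReal.ForestLike.dsum
      (fun A => PolyReal.ForestLike.realize K A) (PolyReal.letterAlphabet S) := by
  constructor
  case dsum_mem => exact fun _ _ => trivial
  case dsum_assoc => exact fun _ _ _ => PolyReal.ForestLike.dsum_assoc _ _ _
  case graded => exact fun _ n _ hx => PolyReal.ForestLike.realize_mem_homogeneous K _ n hx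
  case doubling => exact fun _ _ x => PolyReal.ForestLike.theta_realize K _ _ x
  case mem => trivial
  case injective => exact PolyReal.realize_letterAlphabet_injective K
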